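/- **Setting.** Let $d\in\{2,3\}$ and let $\Omega\subset\mathbb R^d$ be a bounded polyhedral domain without cracks (i.e. $\Omega$ is the interior of its closure). Let $0<\epsilon\le 1$, $\boldsymbol\beta\in W^{1,\infty}(\Omega)^d$ (identified with its representative that is continuous on $\overline\Omega$), $c\in L^\infty(\Omega)$, $f\in L^2(\Omega)$, $g\in H^{1/2}(\partial\Omega)$, with $c-\frac12\operatorname{div}\boldsymbol\beta\ge 0$ a.e. in $\Omega$, and suppose that there are $\psi\in W^{1,\infty}(\Omega)$ and $b_0>0$ with $\boldsymbol\beta\cdot\nabla\psi\ge b_0$ a.e. in $\Omega$. Let $u\in H^1(\Omega)$, $\boldsymbol q\in H(\operatorname{div},\Omega)$ solve $$\epsilon^{-1}\boldsymbol q+\nabla u=0,\qquad \operatorname{div}\boldsymbol q+\boldsymbol\beta\cdot\nabla u+cu=f\quad\text{in }\Omega,\qquad u=g\quad\text{on }\partial\Omega .$$ Let $\mathcal T_h$ be a conforming simplicial triangulation of $\Omega$ that is shape-regular with constant $\kappa$ (each $T\in\mathcal T_h$ contains a ball of radius $r>0$ with $h_T\le\kappa r$), with sets $\mathcal E_h$,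 $\mathcal E_h^0$, $\mathcal E_h^\partial$ of all, interior and boundary faces, and let $h_S=\operatorname{diam}S$ for an element or face $S$. For $p\ge1$ let $\boldsymbol V_h$, $W_h$, $M_h$ be the spaces of functions that restrict to elements of $\mathcal P_p(T)^d$, $\mathcal P_p(T)$ on every $T\in\mathcal T_h$, and of $\mathcal P_p(F)$ on every $F\in\mathcal E_h$, respectively. Write $(\eta,\zeta)_{\mathcal T_h}=\sum_T\int_T\eta\zeta$, $\langle\eta,\zeta\rangle_{\partial\mathcal T_h}=\sum_T\int_{\partial T}\eta\zeta$, and let $\boldsymbol n$ be the unit outward normal of each $T$. Let $(\boldsymbol q_h,u_h,\widehat u_h)\in\boldsymbol V_h\times W_h\times M_h$ be the HDG solution: $$\begin{aligned} &(\epsilon^{-1}\boldsymbol q_h,\boldsymbol r)_{\mathcal T_h}-(u_h,\operatorname{div}\boldsymbol r)_{\mathcal T_h}+\langle\widehat u_h,\boldsymbol r\cdot\boldsymbol n\rangle_{\partial\mathcal T_h}=0,\\ &-(\boldsymbol q_h+\boldsymbol\beta u_h,\nabla w)_{\mathcal T_h}+((c-\operatorname{div}\boldsymbol\beta)u_h,w)_{\mathcal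 T_h}+\langle \widehat\Phi_h,w\rangle_{\partial\mathcal T_h}=(f,w)_{\mathcal T_h},\\ &\langle\widehat u_h,\mu\rangle_{\partial\Omega}=\langle g,\mu\rangle_{\partial\Omega},\qquad \langle\widehat\Phi_h,\mu\rangle_{\partial\mathcal T_h\setminus\partial\Omega}=0 \end{aligned}$$ for all $(\boldsymbol r,w,\mu)\in\boldsymbol V_h\times W_h\times M_h$, where $\widehat\Phi_h=\boldsymbol q_h\cdot\boldsymbol n+(\boldsymbol\beta\cdot\boldsymbol n)\widehat u_h+\tau(u_h-\widehat u_h)$ and $\tau|_F=\max(\sup_{F}\boldsymbol\beta\cdot\boldsymbol n,0)+\min(\rho_0\epsilon/h_T,1)$ for each face $F$ of $T$, with $0<\rho_0\le1$. For an interior face $F=\partial T^+\cap\partial T^-$ put $[\![\phi]\!]=\phi^+-\phi^-$ and $[\![\boldsymbol\sigma\cdot\boldsymbol n]\!]=\boldsymbol\sigma^+\cdot\boldsymbol n^++\boldsymbol\sigma^-\cdot\boldsymbol n^-$ (in the sense of traces, resp. normal traces). Put $R_h|_T=f-\operatorname{div}\boldsymbol q_h-\boldsymbol\beta\cdot\nabla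 u_h-cu_h$, $\alpha_S=\min\{h_S\epsilon^{-1/2},1\}$, $$\gamma_F=\min\Big\{\frac{\epsilon}{h_F}+\Big(\frac{h_F}{\epsilon}+\epsilon^{-1/2}\alpha_F\Big)\|\boldsymbol\beta\|_{L^\infty(F)}+h_F,\ \frac{\epsilon+\|\boldsymbol\beta\|_{L^\infty(F)}}{h_F}+h_F\Big\},$$ and, with $\|\cdot\|_{0,D}$ the $L^2(D)$ norm, $$\begin{aligned}\eta_T&=\big(\alpha_T^2\|R_h\|_{0,T}^2+\epsilon^{-1}\|\boldsymbol q_h+\epsilon\nabla u_h\|_{0,T}^2\big)^{1/2},\\ \eta_F^0&=\big(\epsilon^{-1/2}\alpha_F\|[\![\boldsymbol q_h\cdot\boldsymbol n]\!]\|_{0,F}^2+\gamma_F\|[\![u_h]\!]\|_{0,F}^2\big)^{1/2},\qquad \eta_F^\partial=\gamma_F^{1/2}\|u_h-g\|_{0,F}.\end{aligned}$$ Finally let $osc_h^2(R_h,T)=\alpha_T^2\|R_h-P_WR_h\|_{0,T}^2$, where $P_W$ is the $L^2$ orthogonal projection onto $W_h$. **Theorem (Efficiency).** There is a constant $C_1>0$,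 depending on $d,\Omega,p,\kappa,\boldsymbol\beta,c$ only (in particular independent of $\epsilon$ and of the mesh size), such that $$\begin{aligned} \eta_F^0&\le C_1\big(\epsilon^{-1/2}\alpha_F\|[\![(\boldsymbol q-\boldsymbol q_h)\cdot\boldsymbol n]\!]\|_{0,F}^2+\gamma_F\|[\![u-u_h]\!]\|_{0,F}^2\big)^{1/2}&&\forall F\in\mathcal E_h^0,\\ \eta_F^\partial&\le C_1\big(\gamma_F\|g-u_h\|_{0,F}^2\big)^{1/2}&&\forall F\in\mathcal E_h^\partial,\\ \eta_T&\le C_1\big(\epsilon^{-1}\|\boldsymbol q-\boldsymbol q_h\|_{0,T}^2+\|u-u_h\|_{0,T}^2+\epsilon\|\nabla(u-u_h)\|_{0,T}^2\\ &\qquad+\alpha_T^2\|\operatorname{div}(\boldsymbol q-\boldsymbol q_h)+\boldsymbol\beta\cdot\nabla(u-u_h)\|_{0,T}^2+osc_h^2(R_h,T)\big)^{1/2}&&\forall T\in\mathcal T_h. \end{aligned}$$ -/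

import Mathlib

open MeasureTheory Set
open scoped ContDiff RealInnerProductSpace

noncomputable section

namespace HDG

/-- The Euclidean space `ℝᵈ`. -/
abbrev Pt (d : ℕ) : Type := EuclideanSpace ℝ (Fin d)

variable {d : ℕ}

/-! ### Weak derivatives and Sobolev spaces -/

/-- Smooth test functions with compact support in the set `U` (scalar or vector valued). -/
structure IsTest {G : Type} [NormedAddCommGroup G] [NormedSpace ℝ G]
    (U : Set (Pt d)) (φ : Pt d → G) : Prop where
  smooth : ContDiff ℝ ∞ φ
  compact : HasCompactSupport φ
  support : tsupport φ ⊆ U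

/-- The classical divergence of a vector field. -/
def divergence (σ : Pt d → Pt d) (x : Pt d) : ℝ :=
  ∑ i, (fderiv ℝ σ x (EuclideanSpace.single i 1)) i

/-- `G` is a weak gradient of `w` on the open set `U`. -/
structure IsWeakGrad (U : Set (Pt d)) (w : Pt d → ℝ) (G : Pt d → Pt d) : Prop where
  locInt : LocallyIntegrableOn w U
  locInt_grad : LocallyIntegrableOn G U
  parts : ∀ φ : Pt d → ℝ, IsTest U φ → ∀ v : Pt d,
    ∫ x in U, w x * fderiv ℝ φ x v = - ∫ x in U, ⟪G x, v⟫ * φ x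

/-- `D` is a weak divergence of the vector field `σ` on the open set `U`
(note that `fderiv ℝ φ x (σ x)` is `σ x · ∇φ x`). -/
structure IsWeakDiv (U : Set (Pt d)) (σ : Pt d → Pt d) (D : Pt d → ℝ) : Prop where
  locInt : LocallyIntegrableOn σ U
  locInt_div : LocallyIntegrableOn D U
  parts : ∀ φ : Pt d → ℝ, IsTest U φ →
    ∫ x in U, fderiv ℝ φ x (σ x) = - ∫ x in U, D x * φ x

open Classical in
/-- The weak gradient on `U` (unique almost everywhere on `U` when it exists). -/
def weakGrad (U : Set (Pt d)) (w : Pt d → ℝ) : Pt d → Pt d :=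
  if h : ∃ G, IsWeakGrad U w G then h.choose else 0

open Classical in
/-- The weak divergence on `U` (unique almost everywhere on `U` when it exists). -/
def weakDiv (U : Set (Pt d)) (σ : Pt d → Pt d) : Pt d → ℝ :=
  if h : ∃ D, IsWeakDiv U σ D then h.choose else 0

/-- `w ∈ H¹(U)`. -/
def MemH1 (U : Set (Pt d)) (w : Pt d → ℝ) : Prop :=
  MemLp w 2 (volume.restrict U) ∧
    ∃ G, IsWeakGrad U w G ∧ MemLp G 2 (volume.restrict U)

/-- `σ ∈ H(div, U)`. -/
def MemHdiv (U : Set (Pt d)) (σ : Pt d → Pt d) : Prop :=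
  MemLp σ 2 (volume.restrict U) ∧
    ∃ D, IsWeakDiv U σ D ∧ MemLp D 2 (volume.restrict U)

/-- `w ∈ W^{1,∞}(U)`. -/
def MemW1Inf (U : Set (Pt d)) (w : Pt d → ℝ) : Prop :=
  MemLp w ⊤ (volume.restrict U) ∧
    ∃ G, IsWeakGrad U w G ∧ MemLp G ⊤ (volume.restrict U)

/-! ### Polyhedral domains and the data of the problem -/

/-- A bounded polyhedral domain. The condition `regular` says that the domain has no
cracks. -/
structure IsPolyhedralDomain (Ω : Set (Pt d)) : Prop where
  isOpen : IsOpen Ω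
  connected : IsConnected Ω
  bounded : Bornology.IsBounded Ω
  regular : interior (closure Ω) = Ω
  polyhedral : ∃ S : Finset (Finset (Pt d)),
    closure Ω = ⋃ s ∈ S, convexHull ℝ (s : Set (Pt d))

/-- Assumptions on the coefficients `β` and `c`. The vector field `β ∈ W^{1,∞}(Ω)ᵈ` is given
by its representative that is continuous up to the boundary, so that it has values on
faces. -/
structure AdmissibleCoeff (Ω : Set (Pt d)) (β : Pt d → Pt d) (c : Pt d → ℝ) : Prop where
  beta_mem : ∀ i, MemW1Inf Ω (fun x => β x i)
  beta_cont : ContinuousOn β (closure Ω)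
  c_mem : MemLp c ⊤ (volume.restrict Ω)
  coercive : ∀ᵐ x ∂(volume.restrict Ω), 0 ≤ c x - 1 / 2 * weakDiv Ω β x
  transport : ∃ ψ : Pt d → ℝ, ∃ b₀ : ℝ, MemW1Inf Ω ψ ∧ 0 < b₀ ∧
    ∀ᵐ x ∂(volume.restrict Ω), b₀ ≤ ⟪β x, weakGrad Ω ψ x⟫

/-! ### Meshes -/

/-- The closed simplex with the given vertices. -/
def hull (S : Finset (Pt d)) : Set (Pt d) := convexHull ℝ (S : Set (Pt d))

/-- The diameter `h_S` of an element or a face. -/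
def size (S : Finset (Pt d)) : ℝ := Metric.diam (hull S)

/-- The surface measure on the face with vertices `F`. -/
def faceMeasure (F : Finset (Pt d)) : Measure (Pt d) :=
  (Measure.euclideanHausdorffMeasure (d - 1)).restrict (hull F)

/-- A conforming simplicial triangulation of `Ω`: a finite, pure `d`-dimensional geometric
simplicial complex whose underlying space is the closure of `Ω`. -/
structure Mesh (Ω : Set (Pt d)) where
  complex : Geometry.SimplicialComplex ℝ (Pt d)
  finite : complex.faces.Finite
  pure : ∀ S ∈ complex.faces, ∃ T ∈ complex.faces, S ⊆ T ∧ T.card = d + 1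
  cover : complex.space = closure Ω

namespace Mesh

variable {Ω : Set (Pt d)} (M : Mesh Ω)

/-- The elements `T ∈ 𝒯_h`, given by their sets of vertices. -/
def elements : Finset (Finset (Pt d)) :=
  M.finite.toFinset.filter (fun T => T.card = d + 1)

/-- All faces `F ∈ ℰ_h` (of dimension `d - 1`), given by their sets of vertices. -/
def faces : Finset (Finset (Pt d)) :=
  M.finite.toFinset.filter (fun F => F.card = d)

open Classical in
/-- The faces of the element `T`. -/
def facesOf (T : Finset (Pt d)) : Finset (Finset (Pt d)) :=
  M.faces.filter (fun F => F ⊆ T)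

open Classical in
/-- The interior faces `ℰ_h⁰`: those shared by two elements. -/
def interiorFaces : Finset (Finset (Pt d)) :=
  M.faces.filter (fun F => ∃ T₁ ∈ M.elements, ∃ T₂ ∈ M.elements, T₁ ≠ T₂ ∧ F ⊆ T₁ ∧ F ⊆ T₂)

open Classical in
/-- The boundary faces: those that belong to one element only. -/
def boundaryFaces : Finset (Finset (Pt d)) :=
  M.faces.filter (fun F => ∃! T, T ∈ M.elements ∧ F ⊆ T)

/-- Shape regularity with constant `κ`: every element `T` contains a ball of radius `r > 0`
with `h_T ≤ κ r`. -/
def ShapeRegular (κ : ℝ) : Prop :=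
  ∀ T ∈ M.elements, ∃ z : Pt d, ∃ r : ℝ, 0 < r ∧
    Metric.closedBall z r ⊆ hull T ∧ size T ≤ κ * r

end Mesh

/-- `n` is the unit outward normal of the simplex `T` on its face `F`. -/
structure IsOutwardNormal (T F : Finset (Pt d)) (n : Pt d) : Prop where
  unit : ‖n‖ = 1
  orthogonal : ∀ x ∈ F, ∀ y ∈ F, ⟪n, x - y⟫ = 0
  outward : ∀ x ∈ T, x ∉ F → ∀ y ∈ F, ⟪n, x - y⟫ < 0

open Classical in
/-- The unit outward normal of the simplex `T` on its face `F`. -/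
def normal (T F : Finset (Pt d)) : Pt d :=
  if h : ∃ n, IsOutwardNormal T F n then h.choose else 0

/-! ### Traces and jumps

A function that is smooth on each element only (for instance a finite element function) is a
family of functions indexed by the elements. -/

/-- `J` is the jump `w⁺ - w⁻` on the interior face `F` shared by the elements `T₁` (the `+` side)
and `T₂` (the `-` side) of the elementwise `H¹` function `w`. The traces are expressed by Green's
formula `∫_T (w div Φ + ∇w · Φ) = ∫_{∂T} w Φ · n`, summed over the two elements. -/
structure IsJump (T₁ T₂ F : Finset (Pt d)) (w : Finset (Pt d) → Pt d → ℝ)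
    (J : Pt d → ℝ) : Prop where
  memLp : MemLp J 2 (faceMeasure F)
  green : ∀ Φ : Pt d → Pt d, IsTest (interior (hull T₁ ∪ hull T₂)) Φ →
    (∫ x in hull T₁, (w T₁ x * divergence Φ x + ⟪weakGrad (interior (hull T₁)) (w T₁) x, Φ x⟫))
      + (∫ x in hull T₂, (w T₂ x * divergence Φ x + ⟪weakGrad (interior (hull T₂)) (w T₂) x, Φ x⟫))
      = ∫ x, J x * ⟪normal T₁ F, Φ x⟫ ∂(faceMeasure F)

/-- `J` is the jump `σ⁺ · n⁺ + σ⁻ · n⁻` on the interior face `F` shared by the elements `T₁` and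
`T₂` of the normal component of the elementwise `H(div)` field `σ`. The normal traces are expressed
by Green's formula `∫_T (σ · ∇φ + div σ φ) = ∫_{∂T} σ · n φ`, summed over the two elements. -/
structure IsNormalJump (T₁ T₂ F : Finset (Pt d)) (σ : Finset (Pt d) → Pt d → Pt d)
    (J : Pt d → ℝ) : Prop where
  memLp : MemLp J 2 (faceMeasure F)
  green : ∀ φ : Pt d → ℝ, IsTest (interior (hull T₁ ∪ hull T₂)) φ →
    (∫ x in hull T₁, (fderiv ℝ φ x (σ T₁ x) + weakDiv (interior (hull T₁)) (σ T₁) x * φ x))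
      + (∫ x in hull T₂, (fderiv ℝ φ x (σ T₂ x) + weakDiv (interior (hull T₂)) (σ T₂) x * φ x))
      = ∫ x, J x * φ x ∂(faceMeasure F)

open Classical in
/-- The jump of an elementwise `H¹` function on a face (unique almost everywhere). -/
def jump (T₁ T₂ F : Finset (Pt d)) (w : Finset (Pt d) → Pt d → ℝ) : Pt d → ℝ :=
  if h : ∃ J, IsJump T₁ T₂ F w J then h.choose else 0

open Classical in
/-- The jump of the normal component of an elementwise `H(div)` field on a face (unique almost
everywhere). -/
def normalJump (T₁ T₂ F : Finset (Pt d)) (σ : Finset (Pt d) → Pt d → Pt d) : Pt d → ℝ :=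
  if h : ∃ J, IsNormalJump T₁ T₂ F σ J then h.choose else 0

/-- `g ∈ L²(∂Ω)` is the trace of `w ∈ H¹(Ω)` on `∂Ω` (the union of the boundary faces), by Green's
formula `∫_Ω (w div Φ + ∇w · Φ) = ∫_{∂Ω} g Φ · n` for all smooth fields `Φ`. -/
structure IsBoundaryTrace {Ω : Set (Pt d)} (M : Mesh Ω) (w g : Pt d → ℝ) : Prop where
  memLp : ∀ F ∈ M.boundaryFaces, MemLp g 2 (faceMeasure F)
  green : ∀ Φ : Pt d → Pt d, IsTest univ Φ →
    ∫ x in Ω, (w x * divergence Φ x + ⟪weakGrad Ω w x, Φ x⟫)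
      = ∑ T ∈ M.elements, ∑ F ∈ M.facesOf T with F ∈ M.boundaryFaces,
          ∫ x, g x * ⟪normal T F, Φ x⟫ ∂(faceMeasure F)

/-! ### The exact solution -/

/-- `(q, u)` solves `ε⁻¹ q + ∇u = 0`, `div q + β · ∇u + c u = f` in `Ω` and `u = g` on `∂Ω`, with
`u ∈ H¹(Ω)` and `q ∈ H(div, Ω)`. In particular `g`, being the trace of `u`, is in `H^{1/2}(∂Ω)`. -/
structure IsExactSolution {Ω : Set (Pt d)} (M : Mesh Ω) (ε : ℝ) (β : Pt d → Pt d)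
    (c f g : Pt d → ℝ) (q : Pt d → Pt d) (u : Pt d → ℝ) : Prop where
  u_mem : MemH1 Ω u
  q_mem : MemHdiv Ω q
  flux : ∀ᵐ x ∂(volume.restrict Ω), ε⁻¹ • q x + weakGrad Ω u x = 0
  balance : ∀ᵐ x ∂(volume.restrict Ω),
    weakDiv Ω q x + ⟪β x, weakGrad Ω u x⟫ + c x * u x = f x
  boundary : IsBoundaryTrace M u g

/-! ### The HDG method -/

/-- Polynomials of total degree at most `p` on `ℝᵈ`; their restrictions to a simplex `S` form
`𝒫_p(S)`. -/
def IsPoly (p : ℕ) (w : Pt d → ℝ) : Prop :=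
  ∃ P : MvPolynomial (Fin d) ℝ, P.totalDegree ≤ p ∧ ∀ x, w x = MvPolynomial.eval (fun i => x i) P

section Spaces

variable {Ω : Set (Pt d)} (M : Mesh Ω) (p : ℕ)

/-- The finite element space `V_h`. -/
def MemV (r : Finset (Pt d) → Pt d → Pt d) : Prop :=
  ∀ T ∈ M.elements, ∀ i, IsPoly p (fun x => r T x i)

/-- The finite element space `W_h`. -/
def MemW (w : Finset (Pt d) → Pt d → ℝ) : Prop :=
  ∀ T ∈ M.elements, IsPoly p (w T)

/-- The finite element space `M_h` on the skeleton. -/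
def MemM (μ : Finset (Pt d) → Pt d → ℝ) : Prop :=
  ∀ F ∈ M.faces, IsPoly p (μ F)

end Spaces

/-- The stabilization function `τ` on the face `F` of the element `T`. -/
def tau (ε ρ₀ : ℝ) (β : Pt d → Pt d) (T F : Finset (Pt d)) : ℝ :=
  max (sSup ((fun x => ⟪β x, normal T F⟫) '' hull F)) 0 + min (ρ₀ * (ε / size T)) 1

/-- The normal component of the numerical flux on the face `F` of the element `T`. -/
def numFlux (ε ρ₀ : ℝ) (β : Pt d → Pt d) (qh : Finset (Pt d) → Pt d → Pt d)
    (uh uhat : Finset (Pt d) → Pt d → ℝ) (T F : Finset (Pt d)) (x : Pt d) : ℝ :=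
  ⟪qh T x, normal T F⟫ + ⟪β x, normal T F⟫ * uhat F x
    + tau ε ρ₀ β T F * (uh T x - uhat F x)

/-- `(qh, uh, uhat)` solves the HDG method with polynomial degree `p`. -/
structure IsHDGSolution {Ω : Set (Pt d)} (M : Mesh Ω) (p : ℕ) (ε ρ₀ : ℝ) (β : Pt d → Pt d)
    (c f g : Pt d → ℝ) (qh : Finset (Pt d) → Pt d → Pt d)
    (uh uhat : Finset (Pt d) → Pt d → ℝ) : Prop where
  q_mem : MemV M p qh
  u_mem : MemW M p uh
  uhat_mem : MemM M p uhat
  eq_flux : ∀ r, MemV M p r →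
    ∑ T ∈ M.elements,
      ((∫ x in hull T, ε⁻¹ * ⟪qh T x, r T x⟫) - (∫ x in hull T, uh T x * divergence (r T) x)
        + ∑ F ∈ M.facesOf T, ∫ x, uhat F x * ⟪r T x, normal T F⟫ ∂(faceMeasure F)) = 0
  eq_balance : ∀ w, MemW M p w →
    ∑ T ∈ M.elements,
      (-(∫ x in hull T, ⟪qh T x + uh T x • β x, gradient (w T) x⟫)
        + (∫ x in hull T, (c x - weakDiv Ω β x) * uh T x * w T x)
        + ∑ F ∈ M.facesOf T,
            ∫ x, numFlux ε ρ₀ β qh uh uhat T F x * w T x ∂(faceMeasure F))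
      = ∑ T ∈ M.elements, ∫ x in hull T, f x * w T x
  eq_boundary : ∀ μ, MemM M p μ →
    ∑ F ∈ M.boundaryFaces, ∫ x, uhat F x * μ F x ∂(faceMeasure F)
      = ∑ F ∈ M.boundaryFaces, ∫ x, g x * μ F x ∂(faceMeasure F)
  eq_conservation : ∀ μ, MemM M p μ →
    ∑ T ∈ M.elements, ∑ F ∈ M.facesOf T with F ∉ M.boundaryFaces,
      ∫ x, numFlux ε ρ₀ β qh uh uhat T F x * μ F x ∂(faceMeasure F) = 0

/-! ### The a posteriori error estimator -/

/-- The square `‖w‖²` of the `L²(μ)` norm. -/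
def normSq {G : Type} [NormedAddCommGroup G] (μ : Measure (Pt d)) (w : Pt d → G) : ℝ :=
  ∫ x, ‖w x‖ ^ 2 ∂μ

/-- Lebesgue measure on the element with vertices `T`. -/
def elemMeasure (T : Finset (Pt d)) : Measure (Pt d) := volume.restrict (hull T)

/-- The elementwise residual `R_h`. -/
def residual (β : Pt d → Pt d) (c f : Pt d → ℝ) (qh : Finset (Pt d) → Pt d → Pt d)
    (uh : Finset (Pt d) → Pt d → ℝ) (T : Finset (Pt d)) (x : Pt d) : ℝ :=
  f x - divergence (qh T) x - ⟪β x, gradient (uh T) x⟫ - c x * uh T x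

/-- The weight `α_S` of an element or a face. -/
def alpha (ε : ℝ) (S : Finset (Pt d)) : ℝ := min (size S * ε ^ (-(1 / 2) : ℝ)) 1

/-- `‖β‖_{L^∞(F)}`. -/
def supNorm (β : Pt d → Pt d) (F : Finset (Pt d)) : ℝ :=
  (eLpNorm β ⊤ (faceMeasure F)).toReal

/-- The weight `γ_F` of a face. -/
def gamma (ε : ℝ) (β : Pt d → Pt d) (F : Finset (Pt d)) : ℝ :=
  min (ε / size F + (size F / ε + ε ^ (-(1 / 2) : ℝ) * alpha ε F) * supNorm β F + size F)
    ((ε + supNorm β F) / size F + size F)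

/-- The element estimator `η_T`. -/
def etaElem (ε : ℝ) (β : Pt d → Pt d) (c f : Pt d → ℝ) (qh : Finset (Pt d) → Pt d → Pt d)
    (uh : Finset (Pt d) → Pt d → ℝ) (T : Finset (Pt d)) : ℝ :=
  √(alpha ε T ^ 2 * normSq (elemMeasure T) (residual β c f qh uh T)
    + ε⁻¹ * normSq (elemMeasure T) (fun x => qh T x + ε • gradient (uh T) x))

/-- The estimator `η_F⁰` on the interior face `F` shared by the elements `T₁` and `T₂`; the jumps of
the (piecewise polynomial) discrete solution are those of its point values. -/
def etaInterior (ε : ℝ) (β : Pt d → Pt d) (qh : Finset (Pt d) → Pt d → Pt d)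
    (uh : Finset (Pt d) → Pt d → ℝ) (T₁ T₂ F : Finset (Pt d)) : ℝ :=
  √(ε ^ (-(1 / 2) : ℝ) * alpha ε F
      * normSq (faceMeasure F) (fun x => ⟪qh T₁ x, normal T₁ F⟫ + ⟪qh T₂ x, normal T₂ F⟫)
    + gamma ε β F * normSq (faceMeasure F) (fun x => uh T₁ x - uh T₂ x))

/-- The estimator `η_F^∂` on the boundary face `F` of the element `T`. -/
def etaBoundary (ε : ℝ) (β : Pt d → Pt d) (g : Pt d → ℝ) (uh : Finset (Pt d) → Pt d → ℝ)
    (T F : Finset (Pt d)) : ℝ :=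
  √(gamma ε β F) * √(normSq (faceMeasure F) (fun x => uh T x - g x))

/-- `P` is the `L²` orthogonal projection of `R` onto `W_h`. -/
structure IsProjW {Ω : Set (Pt d)} (M : Mesh Ω) (p : ℕ) (R P : Finset (Pt d) → Pt d → ℝ) :
    Prop where
  mem : MemW M p P
  orthogonal : ∀ w, MemW M p w →
    ∑ T ∈ M.elements, ∫ x in hull T, (R T x - P T x) * w T x = 0

open Classical in
/-- The `L²` orthogonal projection `P_W` onto `W_h`. -/
def projW {Ω : Set (Pt d)} (M : Mesh Ω) (p : ℕ) (R : Finset (Pt d) → Pt d → ℝ) :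
    Finset (Pt d) → Pt d → ℝ :=
  if h : ∃ P, IsProjW M p R P then h.choose else 0

/-- The data oscillation `osc_h²(R, T) = α_T² ‖R - P_W R‖²_{0,T}`. -/
def oscSq {Ω : Set (Pt d)} (M : Mesh Ω) (p : ℕ) (ε : ℝ) (R : Finset (Pt d) → Pt d → ℝ)
    (T : Finset (Pt d)) : ℝ :=
  alpha ε T ^ 2 * normSq (elemMeasure T) (fun x => R T x - projW M p R T x)

end HDG

end

noncomputable section

namespace HDG

section Weak

variable {d : ℕ} {G H : Type} [NormedAddCommGroup G] [NormedSpace ℝ G] [NormedAddCommGroup H]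
  [NormedSpace ℝ H]

/-! ### Integrability against test functions -/

/-! The estimator is compared with the error directly, without bubble functions or inverse
estimates. On an element, the equations for `(q, u)` turn residuals into errors: `R_h = div (q -
q_h) + β · ∇(u - u_h) + c (u - u_h)` and `q_h + ε ∇u_h = -(q - q_h) - ε ∇(u - u_h)`. Squaring, and
using `α_T ≤ 1` for the `c`-term, gives the constant `C₁² = 2 + 2 ‖c‖²_∞`; the oscillation only
enlarges the right-hand side (`etaElem_le`). On a boundary face both sides agree up to a sign inside
the norm.

On an interior face `u ∈ H¹(Ω)` and `q ∈ H(div, Ω)` do not jump, so estimator and error coincide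
(`etaInterior_eq`). Most of the work lies here, since the jumps of the error are defined by Green's
formula and not by point values. Existence is `isJump_sub` and `isNormalJump_sub`: over the patch of
the two elements the contributions of `u` and `q` vanish by the definition of weak derivatives, and
the polynomial contributions become face integrals. The test functions live in the interior of the
patch, where an element looks like a half-space, so the divergence theorem on a half-space suffices
(`AreAdjacent.integral_divergence`). Uniqueness is the fundamental lemma of the calculus of
variations for the surface measure (`ae_eq_of_integral_test`), because almost all of the face lies
in the interior of the patch (`AreAdjacent.ae_mem_interior`). -/

theorem integrable_clm_apply {U : Set (Pt d)} {μ : Measure (Pt d)} {f : Pt d → G}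
    {A : Pt d → G →L[ℝ] H} (hf : LocallyIntegrableOn f U μ) (hA : Continuous A)
    (hc : HasCompactSupport A) (hs : tsupport A ⊆ U) : Integrable (fun x => A x (f x)) μ := by
  have hfK : IntegrableOn f (tsupport A) μ := hf.integrableOn_compact_subset hs hc
  obtain ⟨C, hC⟩ := hA.bounded_above_of_compact_support hc
  have hsupp : Function.support (fun x => A x (f x)) ⊆ tsupport A := by
    intro x hx
    refine subset_tsupport A fun h => hx ?_
    simp [h]
  -- Only the compact set `tsupport A` matters; there `f` is integrable and `A` is bounded.
  rw [← integrableOn_iff_integrable_of_support_subset hsupp]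
  refine Integrable.mono' (hfK.norm.const_mul C) ?_ (ae_of_all _ fun x => ?_)
  · have hA' : AEStronglyMeasurable A (μ.restrict (tsupport A)) :=
      hA.stronglyMeasurable_of_hasCompactSupport hc |>.aestronglyMeasurable
    exact (ContinuousLinearMap.id ℝ (G →L[ℝ] H)).aestronglyMeasurable_comp₂ hA'
      hfK.aestronglyMeasurable
  · exact ((A x).le_opNorm _).trans (mul_le_mul_of_nonneg_right (hC x) (norm_nonneg _))

theorem IsTest.mono {U V : Set (Pt d)} (h : U ⊆ V) {φ : Pt d → G} (hφ : IsTest U φ) :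
    IsTest V φ :=
  ⟨hφ.smooth, hφ.compact, hφ.support.trans h⟩

theorem IsTest.clm_comp {U : Set (Pt d)} {φ : Pt d → G} (hφ : IsTest U φ) (A : G →L[ℝ] H) :
    IsTest U (fun x => A (φ x)) := by
  refine ⟨A.contDiff.comp hφ.smooth, hφ.compact.comp_left (map_zero A), ?_⟩
  exact (tsupport_comp_subset (map_zero A) φ).trans hφ.support

theorem IsTest.smul_const {U : Set (Pt d)} {φ : Pt d → ℝ} (hφ : IsTest U φ) (v : G) :
    IsTest U (fun x => φ x • v) :=
  hφ.clm_comp ((ContinuousLinearMap.id ℝ ℝ).smulRight v)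

theorem IsTest.fderiv {U : Set (Pt d)} {φ : Pt d → G} (hφ : IsTest U φ) :
    IsTest U (fderiv ℝ φ) :=
  ⟨hφ.smooth.fderiv_right (by simp), hφ.compact.fderiv ℝ,
    (tsupport_fderiv_subset ℝ).trans hφ.support⟩

theorem IsTest.differentiable {U : Set (Pt d)} {φ : Pt d → G} (hφ : IsTest U φ) :
    Differentiable ℝ φ :=
  hφ.smooth.differentiable (by simp)

theorem IsTest.integrable_smul {U : Set (Pt d)} {μ : Measure (Pt d)} {φ : Pt d → ℝ}
    (hφ : IsTest U φ) {f : Pt d → G} (hf : LocallyIntegrableOn f U μ) :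
    Integrable (fun x => φ x • f x) μ := by
  have h := hφ.smul_const (ContinuousLinearMap.id ℝ G)
  exact integrable_clm_apply hf h.smooth.continuous h.compact h.support

theorem IsTest.integrable_inner {U : Set (Pt d)} {μ : Measure (Pt d)} {Φ : Pt d → Pt d}
    (hΦ : IsTest U Φ) {f : Pt d → Pt d} (hf : LocallyIntegrableOn f U μ) :
    Integrable (fun x => ⟪f x, Φ x⟫) μ := by
  have h := hΦ.clm_comp (innerSL ℝ : Pt d →L[ℝ] Pt d →L[ℝ] ℝ)
  refine (integrable_clm_apply hf h.smooth.continuous h.compact h.support).congr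
    (ae_of_all _ fun x => ?_)
  exact real_inner_comm (f x) (Φ x)

theorem IsTest.integrable_fderiv {U : Set (Pt d)} {μ : Measure (Pt d)} {φ : Pt d → ℝ}
    (hφ : IsTest U φ) {f : Pt d → Pt d} (hf : LocallyIntegrableOn f U μ) :
    Integrable (fun x => _root_.fderiv ℝ φ x (f x)) μ :=
  integrable_clm_apply hf hφ.fderiv.smooth.continuous hφ.fderiv.compact hφ.fderiv.support

/-! ### The divergence -/

/-- Evaluation of the `i`-th coordinate. -/
def coordL (i : Fin d) : Pt d →L[ℝ] ℝ := EuclideanSpace.proj i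

@[simp] theorem coordL_apply (i : Fin d) (x : Pt d) : coordL i x = x i := rfl

theorem fderiv_coord {σ : Pt d → Pt d} {x : Pt d} (hσ : DifferentiableAt ℝ σ x) (i : Fin d)
    (v : Pt d) : fderiv ℝ (fun y => σ y i) x v = fderiv ℝ σ x v i := by
  have : HasFDerivAt (fun y => coordL i (σ y)) ((coordL i).comp (fderiv ℝ σ x)) x :=
    (coordL i).hasFDerivAt.comp x hσ.hasFDerivAt
  simp only [coordL_apply] at this
  rw [this.fderiv]; rfl

theorem sum_coord_smul_single (v : Pt d) : ∑ i, v i • EuclideanSpace.single i (1 : ℝ) = v := by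
  ext j; simp [Pi.single_apply]

theorem sum_clm_single (A : Pt d →L[ℝ] ℝ) (v : Pt d) :
    ∑ i, v i * A (EuclideanSpace.single i 1) = A v := by
  conv_rhs => rw [← sum_coord_smul_single v]
  simp

theorem divergence_smul {w : Pt d → ℝ} {σ : Pt d → Pt d} {x : Pt d}
    (hw : DifferentiableAt ℝ w x) (hσ : DifferentiableAt ℝ σ x) :
    divergence (fun y => w y • σ y) x = w x * divergence σ x + fderiv ℝ w x (σ x) := by
  unfold divergence
  rw [fderiv_fun_smul hw hσ, ← sum_clm_single (fderiv ℝ w x), Finset.mul_sum,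
    ← Finset.sum_add_distrib]
  refine Finset.sum_congr rfl fun i _ => ?_
  simp [mul_comm]

theorem divergence_eq_sum {σ : Pt d → Pt d} {x : Pt d} (hσ : DifferentiableAt ℝ σ x) :
    divergence σ x = ∑ i, fderiv ℝ (fun y => σ y i) x (EuclideanSpace.single i 1) := by
  simp only [fderiv_coord hσ]; rfl

theorem continuous_divergence {σ : Pt d → Pt d} (hσ : ContDiff ℝ 1 σ) :
    Continuous (divergence σ) := by
  refine continuous_finsetSum _ fun i _ => ?_
  exact (coordL i).continuous.comp
    ((hσ.continuous_fderiv (by simp)).clm_apply continuous_const)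

theorem continuous_gradient {w : Pt d → ℝ} (hw : ContDiff ℝ 1 w) : Continuous (gradient w) :=
  (InnerProductSpace.toDual ℝ (Pt d)).symm.continuous.comp (hw.continuous_fderiv (by simp))

/-- Integration by parts against the constant `1`: only the products have to be integrable, and they
have compact support. -/
theorem integral_fderiv_eq_zero {φ : Pt d → ℝ} (hφ : ContDiff ℝ 1 φ) (hc : HasCompactSupport φ)
    (v : Pt d) : ∫ x, fderiv ℝ φ x v = 0 := by
  have hcont : Continuous fun x => fderiv ℝ φ x v :=
    (hφ.continuous_fderiv (by simp)).clm_apply continuous_const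
  have h := integral_mul_fderiv_eq_neg_fderiv_mul_of_integrable (𝕜 := ℝ)
    (μ := (volume : Measure (Pt d))) (f := fun _ => (1 : ℝ)) (g := φ) (v := v) (by simp)
    (by simpa using hcont.integrable_of_hasCompactSupport (hc.fderiv_apply ℝ v))
    (by simpa using hφ.continuous.integrable_of_hasCompactSupport hc)
    (fun _ _ => by fun_prop) (fun x _ => hφ.differentiable (by simp) x)
  simpa using h

theorem integral_divergence_eq_zero {σ : Pt d → Pt d} (hσ : ContDiff ℝ 1 σ)
    (hc : HasCompactSupport σ) : ∫ x, divergence σ x = 0 := by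
  have hσi (i : Fin d) : ContDiff ℝ 1 fun y => σ y i := (coordL i).contDiff.comp hσ
  have hci (i : Fin d) : HasCompactSupport fun y => σ y i :=
    hc.comp_left (g := fun v : Pt d => v i) rfl
  simp only [divergence_eq_sum (hσ.differentiable (by simp) _)]
  rw [integral_finsetSum]
  · exact Finset.sum_eq_zero fun i _ => integral_fderiv_eq_zero (hσi i) (hci i) _
  · intro i _
    exact Continuous.integrable_of_hasCompactSupport
      (((hσi i).continuous_fderiv (by simp)).clm_apply continuous_const)
      ((hci i).fderiv_apply ℝ _)

theorem support_divergence_subset {σ : Pt d → Pt d} :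
    Function.support (divergence σ) ⊆ tsupport σ := by
  intro x hx
  refine support_fderiv_subset ℝ fun h => hx ?_
  simp [divergence, h]

/-! ### Weak gradients and weak divergences -/

/-- The measure is arbitrary because this serves twice: with Lebesgue measure for uniqueness of weak
derivatives, and with the surface measure for uniqueness of jumps. -/
theorem ae_eq_of_integral_test {U : Set (Pt d)} (hU : IsOpen U) {μ : Measure (Pt d)}
    [CompleteSpace G] {f g : Pt d → G}
    (hf : LocallyIntegrableOn f U μ) (hg : LocallyIntegrableOn g U μ)
    (h : ∀ φ : Pt d → ℝ, IsTest U φ → ∫ x, φ x • f x ∂μ = ∫ x, φ x • g x ∂μ) :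
    ∀ᵐ x ∂μ, x ∈ U → f x = g x := by
  have key := hU.ae_eq_zero_of_integral_contDiff_smul_eq_zero (hf.sub hg) fun φ h1 h2 h3 => by
    have hφ : IsTest U φ := ⟨h1, h2, h3⟩
    simp only [Pi.sub_apply, smul_sub]
    rw [integral_sub (hφ.integrable_smul hf) (hφ.integrable_smul hg), h φ hφ, sub_self]
  filter_upwards [key] with x hx hxU
  exact sub_eq_zero.1 (hx hxU)

theorem IsTest.setIntegral {U : Set (Pt d)} {φ : Pt d → G} (hφ : IsTest U φ) {f : Pt d → H}
    (hf : ∀ x, φ x = 0 → f x = 0) : ∫ x in U, f x = ∫ x, f x :=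
  setIntegral_eq_integral_of_forall_compl_eq_zero fun x hx => hf x <| by
    by_contra h
    exact hx (hφ.support (subset_tsupport _ h))

theorem IsWeakGrad.ae_eq {U : Set (Pt d)} (hU : IsOpen U) {w : Pt d → ℝ} {A B : Pt d → Pt d}
    (hA : IsWeakGrad U w A) (hB : IsWeakGrad U w B) : A =ᵐ[volume.restrict U] B := by
  rw [Filter.EventuallyEq, ae_restrict_iff' hU.measurableSet]
  refine ae_eq_of_integral_test hU hA.locInt_grad hB.locInt_grad fun φ hφ => ?_
  -- Weak gradients are tested one direction at a time, so the vector integrals are compared through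
  -- their inner products with `v`.
  refine ext_inner_left ℝ fun v => ?_
  rw [← integral_inner (hφ.integrable_smul hA.locInt_grad),
    ← integral_inner (hφ.integrable_smul hB.locInt_grad)]
  have h := neg_injective ((hA.parts φ hφ v).symm.trans (hB.parts φ hφ v))
  rw [hφ.setIntegral (fun x hx => by simp [hx]), hφ.setIntegral (fun x hx => by simp [hx])] at h
  simpa only [inner_smul_right, real_inner_comm v, mul_comm] using h

theorem IsWeakDiv.ae_eq {U : Set (Pt d)} (hU : IsOpen U) {σ : Pt d → Pt d} {A B : Pt d → ℝ}
    (hA : IsWeakDiv U σ A) (hB : IsWeakDiv U σ B) : A =ᵐ[volume.restrict U] B := by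
  rw [Filter.EventuallyEq, ae_restrict_iff' hU.measurableSet]
  refine ae_eq_of_integral_test hU hA.locInt_div hB.locInt_div fun φ hφ => ?_
  have h := neg_injective ((hA.parts φ hφ).symm.trans (hB.parts φ hφ))
  rw [hφ.setIntegral (fun x hx => by simp [hx]), hφ.setIntegral (fun x hx => by simp [hx])] at h
  simpa only [smul_eq_mul, mul_comm] using h

theorem IsWeakGrad.weakGrad {U : Set (Pt d)} {w : Pt d → ℝ} {A : Pt d → Pt d}
    (hA : IsWeakGrad U w A) : IsWeakGrad U w (weakGrad U w) := by
  have h : ∃ A, IsWeakGrad U w A := ⟨A, hA⟩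
  rw [HDG.weakGrad, dif_pos h]
  exact h.choose_spec

theorem IsWeakDiv.weakDiv {U : Set (Pt d)} {σ : Pt d → Pt d} {A : Pt d → ℝ}
    (hA : IsWeakDiv U σ A) : IsWeakDiv U σ (weakDiv U σ) := by
  have h : ∃ A, IsWeakDiv U σ A := ⟨A, hA⟩
  rw [HDG.weakDiv, dif_pos h]
  exact h.choose_spec

theorem IsWeakGrad.weakGrad_ae_eq {U : Set (Pt d)} (hU : IsOpen U) {w : Pt d → ℝ}
    {A : Pt d → Pt d} (hA : IsWeakGrad U w A) : HDG.weakGrad U w =ᵐ[volume.restrict U] A :=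
  hA.weakGrad.ae_eq hU hA

theorem IsWeakDiv.weakDiv_ae_eq {U : Set (Pt d)} (hU : IsOpen U) {σ : Pt d → Pt d}
    {A : Pt d → ℝ} (hA : IsWeakDiv U σ A) : HDG.weakDiv U σ =ᵐ[volume.restrict U] A :=
  hA.weakDiv.ae_eq hU hA

theorem IsTest.fderiv_eq_zero {U : Set (Pt d)} {φ : Pt d → G} (hφ : IsTest U φ) {x : Pt d}
    (hx : x ∉ U) : _root_.fderiv ℝ φ x = 0 := by
  by_contra h
  exact hx (hφ.support (support_fderiv_subset ℝ h))

theorem IsTest.eq_zero {U : Set (Pt d)} {φ : Pt d → G} (hφ : IsTest U φ) {x : Pt d}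
    (hx : x ∉ U) : φ x = 0 := by
  by_contra h
  exact hx (hφ.support (subset_tsupport _ h))

theorem IsTest.divergence_eq_zero {U : Set (Pt d)} {φ : Pt d → Pt d} (hφ : IsTest U φ)
    {x : Pt d} (hx : x ∉ U) : divergence φ x = 0 := by
  simp [divergence, hφ.fderiv_eq_zero hx]

/-- A test function on `V` is one on `U`, and all integrands vanish off `V`; both identities are the
same identity over the whole space. -/
theorem IsWeakGrad.mono {U V : Set (Pt d)} (hVU : V ⊆ U) {w : Pt d → ℝ} {A : Pt d → Pt d}
    (hA : IsWeakGrad U w A) : IsWeakGrad V w A := by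
  refine ⟨hA.locInt.mono_set hVU, hA.locInt_grad.mono_set hVU, fun φ hφ v => ?_⟩
  have h := hA.parts φ (hφ.mono hVU) v
  rw [setIntegral_eq_integral_of_forall_compl_eq_zero, setIntegral_eq_integral_of_forall_compl_eq_zero] at h ⊢
  · exact h
  all_goals intro x hx
  all_goals first
    | (simp [hφ.eq_zero hx]; done)
    | simp [hφ.fderiv_eq_zero hx]
    | (simp [(hφ.mono hVU).eq_zero hx]; done)
    | simp [(hφ.mono hVU).fderiv_eq_zero hx]

theorem IsWeakDiv.mono {U V : Set (Pt d)} (hVU : V ⊆ U) {σ : Pt d → Pt d} {A : Pt d → ℝ}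
    (hA : IsWeakDiv U σ A) : IsWeakDiv V σ A := by
  refine ⟨hA.locInt.mono_set hVU, hA.locInt_div.mono_set hVU, fun φ hφ => ?_⟩
  have h := hA.parts φ (hφ.mono hVU)
  rw [setIntegral_eq_integral_of_forall_compl_eq_zero, setIntegral_eq_integral_of_forall_compl_eq_zero] at h ⊢
  · exact h
  all_goals intro x hx
  all_goals first
    | simp [hφ.eq_zero hx]
    | simp [hφ.fderiv_eq_zero hx]
    | simp [(hφ.mono hVU).eq_zero hx]
    | simp [(hφ.mono hVU).fderiv_eq_zero hx]

theorem IsWeakGrad.sub {U : Set (Pt d)} {w w' : Pt d → ℝ} {A B : Pt d → Pt d}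
    (hA : IsWeakGrad U w A) (hB : IsWeakGrad U w' B) :
    IsWeakGrad U (fun x => w x - w' x) (fun x => A x - B x) := by
  refine ⟨hA.locInt.sub hB.locInt, hA.locInt_grad.sub hB.locInt_grad, fun φ hφ v => ?_⟩
  have hv := hφ.fderiv.clm_comp (ContinuousLinearMap.apply ℝ ℝ v)
  have i1 := hv.integrable_smul hA.locInt
  have i2 := hv.integrable_smul hB.locInt
  have i3 := (hφ.smul_const v).integrable_inner hA.locInt_grad
  have i4 := (hφ.smul_const v).integrable_inner hB.locInt_grad
  simp only [smul_eq_mul, ContinuousLinearMap.apply_apply, inner_smul_right, mul_comm] at i1 i2 i3 i4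
  simp only [sub_mul, inner_sub_left]
  rw [integral_sub, integral_sub, hA.parts φ hφ v, hB.parts φ hφ v]
  · ring
  all_goals refine Integrable.integrableOn ?_
  all_goals simpa only [mul_comm] using ‹_›

theorem IsWeakDiv.sub {U : Set (Pt d)} {σ σ' : Pt d → Pt d} {A B : Pt d → ℝ}
    (hA : IsWeakDiv U σ A) (hB : IsWeakDiv U σ' B) :
    IsWeakDiv U (fun x => σ x - σ' x) (fun x => A x - B x) := by
  refine ⟨hA.locInt.sub hB.locInt, hA.locInt_div.sub hB.locInt_div, fun φ hφ => ?_⟩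
  have i1 := hφ.integrable_fderiv hA.locInt
  have i2 := hφ.integrable_fderiv hB.locInt
  have i3 := hφ.integrable_smul hA.locInt_div
  have i4 := hφ.integrable_smul hB.locInt_div
  simp only [smul_eq_mul, mul_comm (φ _)] at i3 i4
  simp only [sub_mul, map_sub]
  rw [integral_sub i1.integrableOn i2.integrableOn, integral_sub i3.integrableOn i4.integrableOn,
    hA.parts φ hφ, hB.parts φ hφ]
  ring

theorem isWeakGrad_gradient {U : Set (Pt d)} {w : Pt d → ℝ} (hw : ContDiff ℝ 1 w) :
    IsWeakGrad U w (gradient w) := by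
  refine ⟨hw.continuous.locallyIntegrable.locallyIntegrableOn U,
    (continuous_gradient hw).locallyIntegrable.locallyIntegrableOn U, fun φ hφ v => ?_⟩
  have hv := hφ.fderiv.clm_comp (ContinuousLinearMap.apply ℝ ℝ v)
  rw [setIntegral_eq_integral_of_forall_compl_eq_zero, setIntegral_eq_integral_of_forall_compl_eq_zero]
  · have i1 := hv.integrable_smul (μ := volume) (hw.continuous.locallyIntegrable.locallyIntegrableOn U)
    have i2 := (hφ.smul_const v).integrable_inner (μ := volume)
      ((continuous_gradient hw).locallyIntegrable.locallyIntegrableOn U)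
    have i3 := hφ.integrable_smul (μ := volume)
      (hw.continuous.locallyIntegrable.locallyIntegrableOn U)
    simp only [inner_gradient_left]
    refine integral_mul_fderiv_eq_neg_fderiv_mul_of_integrable ?_ ?_ ?_
      (fun x _ => hw.differentiable (by simp) x) (fun x _ => hφ.differentiable x)
    · simpa [inner_smul_right, inner_gradient_left, mul_comm] using i2
    · simpa [mul_comm] using i1
    · simpa [mul_comm] using i3
  · intro x hx; simp [hφ.eq_zero hx]
  · intro x hx; simp [hφ.fderiv_eq_zero hx]

/-- The field `φ σ` has compact support, so its divergence `φ div σ + ∇φ · σ` integrates to zero. -/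
theorem isWeakDiv_divergence {U : Set (Pt d)} {σ : Pt d → Pt d} (hσ : ContDiff ℝ 1 σ) :
    IsWeakDiv U σ (divergence σ) := by
  have l1 := hσ.continuous.locallyIntegrable (μ := volume) |>.locallyIntegrableOn U
  have l2 := (continuous_divergence hσ).locallyIntegrable (μ := volume) |>.locallyIntegrableOn U
  refine ⟨l1, l2, fun φ hφ => ?_⟩
  rw [setIntegral_eq_integral_of_forall_compl_eq_zero, setIntegral_eq_integral_of_forall_compl_eq_zero]
  · have h := integral_divergence_eq_zero ((hφ.smooth.of_le (by simp)).smul hσ)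
      (hφ.compact.smul_right (f' := σ))
    have hd (x : Pt d) := divergence_smul (hφ.differentiable x) (hσ.differentiable (by simp) x)
    change ∫ x, divergence (fun y => φ y • σ y) x = 0 at h
    simp only [hd] at h
    have i1 := hφ.integrable_smul l2
    simp only [smul_eq_mul] at i1
    rw [integral_add i1 (hφ.integrable_fderiv l1)] at h
    simp only [mul_comm (divergence _ _)]
    linarith
  · intro x hx; simp [hφ.eq_zero hx]
  · intro x hx; simp [hφ.fderiv_eq_zero hx]

/-- Sum the defining identity over the pairs `(Φ i, e_i)` of a scalar test function and a coordinate
direction. This is the form that Green's formula in `IsJump` needs. -/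
theorem IsWeakGrad.parts_vector {U : Set (Pt d)} {w : Pt d → ℝ} {A : Pt d → Pt d}
    (hA : IsWeakGrad U w A) {Φ : Pt d → Pt d} (hΦ : IsTest U Φ) :
    ∫ x in U, (w x * divergence Φ x + ⟪A x, Φ x⟫) = 0 := by
  have hi (i : Fin d) : IsTest U fun x => Φ x i := hΦ.clm_comp (coordL i)
  have hp (i : Fin d) := hA.parts _ (hi i) (EuclideanSpace.single i 1)
  have e (x : Pt d) : w x * divergence Φ x + ⟪A x, Φ x⟫ =
      ∑ i, (w x * fderiv ℝ (fun x => Φ x i) x (EuclideanSpace.single i 1)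
        + ⟪A x, EuclideanSpace.single i 1⟫ * Φ x i) := by
    rw [divergence_eq_sum (hΦ.differentiable x), Finset.mul_sum, Finset.sum_add_distrib]
    congr 1
    simp [PiLp.inner_apply, mul_comm]
  have i1 (i : Fin d) : Integrable (fun x => w x * fderiv ℝ (fun x => Φ x i) x
      (EuclideanSpace.single i 1)) (volume.restrict U) := by
    have := ((hi i).fderiv.clm_comp (ContinuousLinearMap.apply ℝ ℝ
      (EuclideanSpace.single i 1))).integrable_smul hA.locInt
    exact this.restrict.congr (ae_of_all _ fun x => by simp [mul_comm])
  have i2 (i : Fin d) : Integrable (fun x => ⟪A x, EuclideanSpace.single i 1⟫ * Φ x i)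
      (volume.restrict U) := by
    have := ((hi i).smul_const (EuclideanSpace.single i (1 : ℝ))).integrable_inner hA.locInt_grad
    exact this.restrict.congr (ae_of_all _ fun x => by simp [inner_smul_right, mul_comm])
  simp only [e]
  rw [integral_finsetSum]
  swap
  · exact fun i _ => (i1 i).add (i2 i)
  refine Finset.sum_eq_zero fun i _ => ?_
  rw [integral_add (i1 i) (i2 i), hp i]
  ring

/-! ### Polynomials -/

theorem IsPoly.contDiff {p : ℕ} {w : Pt d → ℝ} (hw : IsPoly p w) {n : WithTop ℕ∞} :
    ContDiff ℝ n w := by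
  obtain ⟨P, -, hP⟩ := hw
  rw [funext hP]
  clear hP
  induction P using MvPolynomial.induction_on with
  | C a => simpa using contDiff_const
  | add P Q hP hQ => simpa using hP.add hQ
  | mul_X P i hP => simpa using hP.mul (coordL i).contDiff

theorem contDiff_of_isPoly {p : ℕ} {σ : Pt d → Pt d} (hσ : ∀ i, IsPoly p fun x => σ x i)
    {n : WithTop ℕ∞} : ContDiff ℝ n σ :=
  contDiff_euclidean.2 fun i => (hσ i).contDiff

end Weak

/-! ### The divergence theorem on a half-space -/

section HalfSpace

/-- With the support of `g` inside a sup-norm ball of radius `R`, the half-space may be replaced by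
the box `[-R, 0] × [-R, R]^m`. The divergence theorem on the box, for the field `g v`, leaves only
the side on the wall `t 0 = 0`. -/
theorem setIntegral_coord_nonpos_fderiv {m : ℕ} {g : (Fin (m + 1) → ℝ) → ℝ}
    (hg : ContDiff ℝ 1 g) (hc : HasCompactSupport g) (v : Fin (m + 1) → ℝ) :
    ∫ t in {t | t 0 ≤ 0}, fderiv ℝ g t v = v 0 * ∫ s : Fin m → ℝ, g (Fin.cons 0 s) := by
  obtain ⟨R, hR0, hR⟩ := hc.isCompact.isBounded.subset_ball_lt 0 0
  have hz (t : Fin (m + 1) → ℝ) (i : Fin (m + 1)) (hi : R ≤ |t i|) : t ∉ tsupport g := by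
    intro ht
    have h1 := hR ht
    rw [mem_ball_zero_iff, pi_norm_lt_iff hR0] at h1
    exact absurd (h1 i) (by simpa using hi)
  have hg0 (t : Fin (m + 1) → ℝ) (i : Fin (m + 1)) (hi : R ≤ |t i|) : g t = 0 :=
    image_eq_zero_of_notMem_tsupport (hz t i hi)
  have hd0 (t : Fin (m + 1) → ℝ) (i : Fin (m + 1)) (hi : R ≤ |t i|) : fderiv ℝ g t = 0 := by
    by_contra h
    exact hz t i hi (support_fderiv_subset ℝ h)
  let a : Fin (m + 1) → ℝ := fun _ => -R
  -- The upper corner has first coordinate `0`, so that one side of the box lies on the wall.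
  let b : Fin (m + 1) → ℝ := Fin.cons 0 fun _ => R
  have hab : a ≤ b := by
    intro i
    refine Fin.cases ?_ (fun j => ?_) i <;> simp [a, b] <;> linarith
  have hsub : Icc a b ⊆ {t | t 0 ≤ 0} := fun t ht => by simpa [b] using ht.2 0
  have hset : ∫ t in {t | t 0 ≤ 0}, fderiv ℝ g t v = ∫ t in Icc a b, fderiv ℝ g t v := by
    refine setIntegral_eq_of_subset_of_forall_sdiff_eq_zero
      (measurableSet_le (measurable_pi_apply 0) measurable_const) hsub fun t ht => ?_
    have : ∃ i, R ≤ |t i| := by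
      by_contra! h
      refine ht.2 ⟨fun i => (abs_lt.1 (h i)).1.le, fun i => ?_⟩
      have h0 : t 0 ≤ 0 := ht.1
      refine Fin.cases ?_ (fun j => ?_) i
      · simpa [b] using h0
      · simpa [b] using (abs_lt.1 (h j.succ)).2.le
    obtain ⟨i, hi⟩ := this
    simp [hd0 t i hi]
  have hsum (t : Fin (m + 1) → ℝ) :
      ∑ i, (v i • fderiv ℝ g t) (Pi.single i 1) = fderiv ℝ g t v := by
    conv_rhs => rw [pi_eq_sum_univ' v]
    simp
  have hcont : Continuous fun t => fderiv ℝ g t v :=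
    (hg.continuous_fderiv (by simp)).clm_apply continuous_const
  have key := integral_divergence_of_hasFDerivAt_off_countable' a b hab
    (fun i t => v i * g t) (fun i t => v i • fderiv ℝ g t) ∅ countable_empty
    (fun i => (hg.continuous.const_mul (v i)).continuousOn)
    (fun t _ i => ((hg.differentiable (by simp) t).hasFDerivAt.const_mul (v i)))
    (by simpa only [hsum] using hcont.integrableOn_Icc)
  simp only [hsum] at key
  rw [hset, key, Fin.sum_univ_succ, Finset.sum_eq_zero, add_zero, sub_eq_self.2]
  · rw [integral_const_mul]
    congr 1
    refine (setIntegral_eq_integral_of_forall_compl_eq_zero fun s hs => ?_).trans ?_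
    · have : ∃ i, R ≤ |s i| := by
        by_contra! h
        exact hs ⟨fun i => by simpa [a] using (abs_lt.1 (h i)).1.le,
          fun i => by simpa [b] using (abs_lt.1 (h i)).2.le⟩
      obtain ⟨i, hi⟩ := this
      exact hg0 _ i.succ (by simpa using hi)
    · simp [b]
  · refine integral_eq_zero_of_ae (ae_of_all _ fun s => ?_)
    have h := hg0 (Fin.cons (a 0) s) 0 (by simp [a, le_abs])
    simp [h]
  · intro j _
    rw [integral_eq_zero_of_ae (ae_of_all _ fun s => ?_),
      integral_eq_zero_of_ae (ae_of_all _ fun s => ?_), sub_zero]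
    · simp [hg0 (Fin.insertNth j.succ (a j.succ) s) j.succ (by simp [a, le_abs])]
    · simp [hg0 (Fin.insertNth j.succ (b j.succ) s) j.succ (by simp [b, le_abs])]

variable {m : ℕ} (b : OrthonormalBasis (Fin (m + 1)) ℝ (Pt (m + 1))) (y : Pt (m + 1))

/-- The linear part of `frameMap`. -/
def frameLin : (Fin (m + 1) → ℝ) →L[ℝ] Pt (m + 1) :=
  (b.repr.symm.toContinuousLinearEquiv : Pt (m + 1) →L[ℝ] Pt (m + 1)).comp
    ((EuclideanSpace.equiv (Fin (m + 1)) ℝ).symm : (Fin (m + 1) → ℝ) →L[ℝ] Pt (m + 1))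

/-- Cartesian coordinates with origin `y` and axes `b`. -/
def frameMap (t : Fin (m + 1) → ℝ) : Pt (m + 1) := y + frameLin b t

theorem frameLin_apply (t : Fin (m + 1) → ℝ) : frameLin b t = b.repr.symm (WithLp.toLp 2 t) := rfl

theorem inner_frameLin (t : Fin (m + 1) → ℝ) (i : Fin (m + 1)) : ⟪b i, frameLin b t⟫ = t i := by
  rw [← b.repr_apply_apply, frameLin_apply, LinearIsometryEquiv.apply_symm_apply]

theorem frameLin_inner (v : Pt (m + 1)) : frameLin b (fun i => ⟪b i, v⟫) = v := by
  rw [frameLin_apply, LinearIsometryEquiv.symm_apply_eq]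
  ext i
  simp [b.repr_apply_apply]

theorem measurePreserving_frameMap : MeasurePreserving (frameMap b y) volume volume :=
  (measurePreserving_add_left volume y).comp
    (b.measurePreserving_repr_symm.comp (PiLp.volume_preserving_toLp (Fin (m + 1))))

/-- `frameMap` as a homeomorphism. -/
def frameHomeo : (Fin (m + 1) → ℝ) ≃ₜ Pt (m + 1) :=
  ((EuclideanSpace.equiv (Fin (m + 1)) ℝ).symm.toHomeomorph.trans b.repr.symm.toHomeomorph).trans
    (Homeomorph.addLeft y)

theorem hasFDerivAt_frameMap (t : Fin (m + 1) → ℝ) :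
    HasFDerivAt (frameMap b y) (frameLin b) t :=
  (frameLin b).hasFDerivAt.const_add y

/-- Cartesian coordinates on the hyperplane through `y` orthogonal to `b 0`. -/
def wallMap (s : Pt m) : Pt (m + 1) := frameMap b y (Fin.cons 0 s)

theorem isometry_wallMap : Isometry (wallMap b y) := by
  refine Isometry.of_dist_eq fun s s' => ?_
  rw [wallMap, wallMap, frameMap, frameMap, dist_add_left, frameLin_apply, frameLin_apply,
    LinearIsometryEquiv.dist_map, EuclideanSpace.dist_eq, EuclideanSpace.dist_eq,
    Fin.sum_univ_succ]
  simp

theorem range_wallMap : range (wallMap b y) = {x | ⟪b 0, x - y⟫ = 0} := by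
  ext x
  constructor
  · rintro ⟨s, rfl⟩
    simp [wallMap, frameMap, inner_frameLin]
  · intro hx
    refine ⟨WithLp.toLp 2 fun i => ⟪b i.succ, x - y⟫, ?_⟩
    have : (Fin.cons 0 fun i : Fin m => ⟪b i.succ, x - y⟫ : Fin (m + 1) → ℝ)
        = fun i => ⟪b i, x - y⟫ := by
      ext i
      refine Fin.cases ?_ (fun j => ?_) i
      · simpa using hx.symm
      · simp
    simp only [wallMap, frameMap]
    rw [this, frameLin_inner]
    abel

/-- The wall is an isometric copy of `ℝ^m`; isometries carry the normalised Hausdorff measure along,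
and on `ℝ^m` it is Lebesgue measure. All facts about the surface measure below rest on this. -/
theorem map_wallMap : (volume : Measure (Pt m)).map (wallMap b y)
    = (Measure.euclideanHausdorffMeasure m).restrict {x | ⟪b 0, x - y⟫ = 0} := by
  rw [← range_wallMap, ← (isometry_wallMap b y).map_euclideanHausdorffMeasure,
    EuclideanSpace.euclideanHausdorffMeasure_eq_volume]

theorem setIntegral_wall (f : Pt (m + 1) → ℝ) :
    ∫ x in {x | ⟪b 0, x - y⟫ = 0}, f x ∂(Measure.euclideanHausdorffMeasure m)
      = ∫ s : Fin m → ℝ, f (frameMap b y (Fin.cons 0 s)) := by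
  rw [← map_wallMap, (isometry_wallMap b y).isClosedEmbedding.measurableEmbedding.integral_map]
  exact ((PiLp.volume_preserving_toLp (Fin m)).integral_comp
    (EuclideanSpace.equiv (Fin m) ℝ).symm.toHomeomorph.measurableEmbedding _).symm

/-- The frame is measure preserving and puts the wall at `t 0 = 0`, so the coordinate version
applies in the direction with components `⟪b i, v⟫`. -/
theorem setIntegral_halfSpace_fderiv {φ : Pt (m + 1) → ℝ} (hφ : ContDiff ℝ 1 φ)
    (hc : HasCompactSupport φ) (v : Pt (m + 1)) :
    ∫ x in {x | ⟪b 0, x - y⟫ ≤ 0}, fderiv ℝ φ x v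
      = ⟪b 0, v⟫ * ∫ x in {x | ⟪b 0, x - y⟫ = 0}, φ x ∂(Measure.euclideanHausdorffMeasure m) := by
  have hsm : ContDiff ℝ 1 (frameMap b y) := contDiff_const.add (frameLin b).contDiff
  have key := setIntegral_coord_nonpos_fderiv (hφ.comp hsm)
    (hc.comp_homeomorph (frameHomeo b y)) fun i => ⟪b i, v⟫
  rw [setIntegral_wall, ← (measurePreserving_frameMap b y).setIntegral_preimage_emb
    (frameHomeo b y).measurableEmbedding]
  refine Eq.trans ?_ key
  have hpre : frameMap b y ⁻¹' {x | ⟪b 0, x - y⟫ ≤ 0} = {t | t 0 ≤ 0} := by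
    ext t; simp [frameMap, inner_frameLin]
  rw [hpre]
  refine integral_congr_ae (ae_of_all _ fun t => ?_)
  have := ((hφ.differentiable (by simp) (frameMap b y t)).hasFDerivAt.comp t
    (hasFDerivAt_frameMap b y t)).fderiv
  simp only [this, ContinuousLinearMap.comp_apply, frameLin_inner]

/-- An orthonormal basis with a prescribed first vector. -/
theorem exists_orthonormalBasis_zero {n : Pt (m + 1)} (hn : ‖n‖ = 1) :
    ∃ b : OrthonormalBasis (Fin (m + 1)) ℝ (Pt (m + 1)), b 0 = n := by
  have h : Orthonormal ℝ (({0} : Set (Fin (m + 1))).domRestrict fun _ => n) := by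
    refine ⟨fun _ => hn, fun i j hij => absurd (Subsingleton.elim i j) hij⟩
  obtain ⟨b, hb⟩ := h.exists_orthonormalBasis_extension_of_card_eq (by simp)
  exact ⟨b, hb 0 rfl⟩

/-- Apply the directional formula to the `i`-th component in the direction `e_i`; the factors `⟪n,
e_i⟫` reassemble the normal component. -/
theorem setIntegral_halfSpace_divergence {n : Pt (m + 1)} (hn : ‖n‖ = 1) (y : Pt (m + 1))
    {σ : Pt (m + 1) → Pt (m + 1)} (hσ : ContDiff ℝ 1 σ) (hc : HasCompactSupport σ) :
    ∫ x in {x | ⟪n, x - y⟫ ≤ 0}, divergence σ x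
      = ∫ x in {x | ⟪n, x - y⟫ = 0}, ⟪n, σ x⟫ ∂(Measure.euclideanHausdorffMeasure m) := by
  obtain ⟨b, rfl⟩ := exists_orthonormalBasis_zero hn
  have hσi (i : Fin (m + 1)) : ContDiff ℝ 1 fun y => σ y i := (coordL i).contDiff.comp hσ
  have hci (i : Fin (m + 1)) : HasCompactSupport fun y => σ y i :=
    hc.comp_left (g := fun v : Pt (m + 1) => v i) rfl
  have hw (i : Fin (m + 1)) : Integrable (fun x => σ x i)
      ((Measure.euclideanHausdorffMeasure m).restrict {x | ⟪b 0, x - y⟫ = 0}) := by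
    rw [← map_wallMap, (isometry_wallMap b y).isClosedEmbedding.measurableEmbedding.integrable_map_iff]
    exact ((hσi i).continuous.comp (isometry_wallMap b y).continuous).integrable_of_hasCompactSupport
      ((hci i).comp_isClosedEmbedding (isometry_wallMap b y).isClosedEmbedding)
  have hin (x : Pt (m + 1)) : ⟪b 0, σ x⟫ = ∑ i, b 0 i * σ x i := by
    simp [PiLp.inner_apply, mul_comm]
  simp only [divergence_eq_sum (hσ.differentiable (by simp) _), hin]
  rw [integral_finsetSum, integral_finsetSum]
  · refine Finset.sum_congr rfl fun i _ => ?_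
    have hb : ⟪b 0, EuclideanSpace.single i (1 : ℝ)⟫ = b 0 i := by
      simp [EuclideanSpace.inner_single_right]
    rw [setIntegral_halfSpace_fderiv b y (hσi i) (hci i), ← integral_const_mul, hb]
  · intro i _
    exact (hw i).const_mul (b 0 i)
  · intro i _
    exact (Continuous.integrable_of_hasCompactSupport
      (((hσi i).continuous_fderiv (by simp)).clm_apply continuous_const)
      ((hci i).fderiv_apply ℝ _)).restrict

end HalfSpace

/-! ### Geometry of simplices -/

section Simplex

variable {d : ℕ} {T F : Finset (Pt d)}

/-- `T` is the vertex set of a nondegenerate `d`-simplex. -/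
structure IsSimplex (T : Finset (Pt d)) : Prop where
  indep : AffineIndependent ℝ ((↑) : T → Pt d)
  card : T.card = d + 1

/-- The vertices of a nondegenerate simplex, as an affine basis. -/
def IsSimplex.basis (hT : IsSimplex T) : AffineBasis T ℝ (Pt d) :=
  ⟨(↑), hT.indep, by
    rw [hT.indep.affineSpan_eq_top_iff_card_eq_finrank_add_one]
    simp [hT.card]⟩

theorem IsSimplex.basis_apply (hT : IsSimplex T) (i : T) : hT.basis i = (i : Pt d) := rfl

theorem IsSimplex.mem_hull_iff (hT : IsSimplex T) {x : Pt d} :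
    x ∈ hull T ↔ ∀ i, 0 ≤ hT.basis.coord i x := by
  have h := hT.basis.convexHull_eq_nonneg_coord
  have hr : range hT.basis = (T : Set (Pt d)) := Subtype.range_coe
  rw [hr] at h
  rw [hull, h]
  rfl

theorem convex_hull (S : Finset (Pt d)) : Convex ℝ (hull S) := convex_convexHull ℝ _

theorem isCompact_hull (S : Finset (Pt d)) : IsCompact (hull S) :=
  S.finite_toSet.isCompact_convexHull ℝ

theorem measurableSet_hull (S : Finset (Pt d)) : MeasurableSet (hull S) :=
  (isCompact_hull S).isClosed.measurableSet

theorem hull_mono {S S' : Finset (Pt d)} (h : S ⊆ S') : hull S ⊆ hull S' :=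
  convexHull_mono (Finset.coe_subset.2 h)

theorem subset_hull {S : Finset (Pt d)} {x : Pt d} (hx : x ∈ S) : x ∈ hull S :=
  subset_convexHull ℝ _ (Finset.mem_coe.2 hx)

/-- `F` is the vertex set of a facet of the simplex `T`, opposite to the vertex `a`. -/
structure IsFacet (T F : Finset (Pt d)) (a : Pt d) : Prop where
  simplex : IsSimplex T
  sub : F ⊆ T
  mem : a ∈ T
  notMem : a ∉ F
  eq_or : ∀ v ∈ T, v = a ∨ v ∈ F

theorem IsSimplex.exists_isFacet (hT : IsSimplex T) (hF : F ⊆ T) (hc : F.card = d) :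
    ∃ a, IsFacet T F a := by
  classical
  have h1 : (T \ F).card = 1 := by rw [Finset.card_sdiff_of_subset hF, hT.card, hc]; simp
  obtain ⟨a, ha⟩ := Finset.card_eq_one.1 h1
  have hmem (v : Pt d) : v ∈ T ∧ v ∉ F ↔ v = a := by
    rw [← Finset.mem_sdiff, ha, Finset.mem_singleton]
  refine ⟨a, hT, hF, ((hmem a).2 rfl).1, ((hmem a).2 rfl).2, fun v hv => ?_⟩
  by_cases h : v ∈ F
  · exact Or.inr h
  · exact Or.inl ((hmem v).1 ⟨hv, h⟩)

namespace IsFacet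

variable {a : Pt d} (h : IsFacet T F a)
include h

/-- The barycentric coordinate of the vertex opposite to the facet. -/
def height : Pt d →ᵃ[ℝ] ℝ := h.simplex.basis.coord ⟨a, h.mem⟩

theorem height_self : h.height a = 1 := h.simplex.basis.coord_apply_eq ⟨a, h.mem⟩

theorem height_of_mem {v : Pt d} (hv : v ∈ F) : h.height v = 0 :=
  h.simplex.basis.coord_apply_ne (i := ⟨a, h.mem⟩) (j := ⟨v, h.sub hv⟩) fun he =>
    h.notMem (by rw [show a = v from congrArg Subtype.val he]; exact hv)

theorem height_nonneg {x : Pt d} (hx : x ∈ hull T) : 0 ≤ h.height x :=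
  h.simplex.mem_hull_iff.1 hx _

theorem height_of_mem_hull {x : Pt d} (hx : x ∈ hull F) : h.height x = 0 := by
  have hsub : hull F ⊆ h.height ⁻¹' {0} :=
    convexHull_min (fun v hv => h.height_of_mem hv) ((convex_singleton 0).affine_preimage _)
  exact hsub hx

/-- Dropping the vanishing barycentric coordinate leaves a convex combination of the vertices of
`F`. -/
theorem mem_hull_facet {x : Pt d} (hx : x ∈ hull T) (h0 : h.height x = 0) : x ∈ hull F := by
  classical
  have hs := h.simplex.basis.linear_combination_coord_eq_self x
  have h1 := h.simplex.basis.sum_coord_apply_eq_one x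
  have h2 := Finset.sum_erase Finset.univ (f := fun i => h.simplex.basis.coord i x)
    (a := ⟨a, h.mem⟩) h0
  have h3 := Finset.sum_erase Finset.univ
    (f := fun i => h.simplex.basis.coord i x • h.simplex.basis i)
    (a := ⟨a, h.mem⟩) (smul_eq_zero_of_left h0 _)
  rw [← hs, ← h3]
  refine (convex_hull F).sum_mem (fun i _ => h.simplex.mem_hull_iff.1 hx i) (h2.trans h1)
    fun i hi => ?_
  refine subset_hull ((h.eq_or i i.2).resolve_left fun he => ?_)
  exact Finset.ne_of_mem_erase hi (Subtype.ext he)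

/-- Both sides are affine in `x` and agree at the vertices: they vanish on `F` and coincide at `a`.
This translates between normals and barycentric coordinates. -/
theorem inner_eq {n y : Pt d} (hn : ∀ v ∈ F, ⟪n, v - y⟫ = 0) (x : Pt d) :
    ⟪n, x - y⟫ = ⟪n, a - y⟫ * h.height x := by
  have hs := h.simplex.basis.linear_combination_coord_eq_self x
  have h1 := h.simplex.basis.sum_coord_apply_eq_one x
  have hx : x - y = ∑ i, h.simplex.basis.coord i x • ((i : Pt d) - y) := by
    simp only [smul_sub, Finset.sum_sub_distrib, ← Finset.sum_smul, h1, one_smul]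
    exact congrArg (· - y) hs.symm
  rw [hx, inner_sum, Finset.sum_eq_single ⟨a, h.mem⟩]
  · rw [inner_smul_right, mul_comm]; rfl
  · intro i _ hi
    rw [inner_smul_right, hn i ((h.eq_or i i.2).resolve_left fun he => hi (Subtype.ext he)),
      mul_zero]
  · simp

/-- The normal is minus the normalised gradient of the barycentric coordinate of the opposite
vertex. -/
theorem exists_isOutwardNormal (hF : F.Nonempty) : ∃ n, IsOutwardNormal T F n := by
  let g : Pt d := (InnerProductSpace.toDual ℝ (Pt d)).symm
    (LinearMap.toContinuousLinearMap h.height.linear)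
  have hg (x y : Pt d) : ⟪g, x - y⟫ = h.height x - h.height y := by
    simp only [g, InnerProductSpace.toDual_symm_apply]
    exact h.height.linearMap_vsub x y
  obtain ⟨y, hy⟩ := hF
  have hg0 : 0 < ‖g‖ := by
    refine norm_pos_iff.2 fun h0 => ?_
    have := hg a y
    rw [h0, h.height_self, h.height_of_mem hy] at this
    simp at this
  refine ⟨-(‖g‖⁻¹ • g), ?_, fun x hx z hz => ?_, fun x hx hxF z hz => ?_⟩
  · rw [norm_neg, norm_smul, norm_inv, norm_norm, inv_mul_cancel₀ hg0.ne']
  · rw [inner_neg_left, real_inner_smul_left, hg, h.height_of_mem hx, h.height_of_mem hz]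
    simp
  · obtain rfl := (h.eq_or x hx).resolve_right hxF
    rw [inner_neg_left, real_inner_smul_left, hg, h.height_self, h.height_of_mem hz]
    simp [hg0]

theorem isOutwardNormal_normal (hF : F.Nonempty) : IsOutwardNormal T F (normal T F) := by
  have hex := h.exists_isOutwardNormal hF
  rw [normal, dif_pos hex]
  exact hex.choose_spec

variable {n y : Pt d} (hn : IsOutwardNormal T F n) (hy : y ∈ F)
include hn hy

theorem inner_normal_eq (x : Pt d) : ⟪n, x - y⟫ = ⟪n, a - y⟫ * h.height x :=
  h.inner_eq (fun v hv => hn.orthogonal v hv y hy) x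

theorem inner_opposite_neg : ⟪n, a - y⟫ < 0 := hn.outward a h.mem h.notMem y hy

theorem inner_normal_nonpos_iff (x : Pt d) : ⟪n, x - y⟫ ≤ 0 ↔ 0 ≤ h.height x := by
  rw [h.inner_normal_eq hn hy, ← neg_nonneg, ← neg_mul,
    mul_nonneg_iff_of_pos_left (neg_pos.2 (h.inner_opposite_neg hn hy))]

theorem inner_normal_eq_zero_iff (x : Pt d) : ⟪n, x - y⟫ = 0 ↔ h.height x = 0 := by
  rw [h.inner_normal_eq hn hy, mul_eq_zero, or_iff_right (h.inner_opposite_neg hn hy).ne]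

theorem normal_unique {n' : Pt d} (hn' : IsOutwardNormal T F n') : n = n' := by
  have h1 := h.inner_opposite_neg hn hy
  have h2 := h.inner_opposite_neg hn' hy
  set s := ⟪n, a - y⟫
  set s' := ⟪n', a - y⟫
  -- Both normals are multiples of the gradient of the same height function. Equal norms and equal
  -- signs of `s`, `s'` then force equality.
  have key : s' • n = s • n' := by
    refine ext_inner_right ℝ fun w => ?_
    have e1 := h.inner_normal_eq hn hy (w + y)
    have e2 := h.inner_normal_eq hn' hy (w + y)
    rw [add_sub_cancel_right] at e1 e2
    rw [real_inner_smul_left, real_inner_smul_left, e1, e2]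
    ring
  have hnorm := congrArg norm key
  rw [norm_smul, norm_smul, hn.unit, hn'.unit, Real.norm_of_nonpos h1.le,
    Real.norm_of_nonpos h2.le] at hnorm
  have hs : s' = s := by linarith
  rw [hs] at key
  exact smul_right_injective _ h1.ne key

end IsFacet

end Simplex

/-! ### Adjacent simplices -/

section Adjacent

variable {d : ℕ} {T₁ T₂ F : Finset (Pt d)} {a₁ a₂ : Pt d}

/-- Two simplices that meet in the common facet `F` only. -/
structure AreAdjacent (T₁ T₂ F : Finset (Pt d)) (a₁ a₂ : Pt d) : Prop where
  facet₁ : IsFacet T₁ F a₁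
  facet₂ : IsFacet T₂ F a₂
  inter : hull T₁ ∩ hull T₂ ⊆ hull F

namespace AreAdjacent

variable (h : AreAdjacent T₁ T₂ F a₁ a₂)
include h

theorem symm : AreAdjacent T₂ T₁ F a₂ a₁ := ⟨h.facet₂, h.facet₁, by rw [inter_comm]; exact h.inter⟩

/-- Otherwise the segment from the barycentre of `F` towards `a₂`, which stays in `T₂`, would begin
inside `T₁` at points of positive height, although the simplices meet only in `F`. -/
theorem height_nonpos (hF : F.Nonempty) : h.facet₁.height a₂ ≤ 0 := by
  classical
  by_contra! hpos
  let B := h.facet₁.simplex.basis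
  let i₀ : T₁ := ⟨a₁, h.facet₁.mem⟩
  let s : Finset T₁ := Finset.univ.erase i₀
  have hs : s.Nonempty := by
    obtain ⟨v, hv⟩ := hF
    refine ⟨⟨v, h.facet₁.sub hv⟩, Finset.mem_erase.2 ⟨fun he => ?_, Finset.mem_univ _⟩⟩
    have he' : v = a₁ := congrArg Subtype.val he
    exact h.facet₁.notMem (he' ▸ hv)
  let z : Pt d := s.centroid ℝ B
  have hzi (i : T₁) (hi : i ≠ i₀) : 0 < B.coord i z := by
    rw [B.coord_apply_centroid (Finset.mem_erase.2 ⟨hi, Finset.mem_univ _⟩)]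
    have := hs.card_pos
    positivity
  have hz0 : B.coord i₀ z = 0 :=
    B.coord_apply_combination_of_notMem (Finset.notMem_erase _ _)
      (s.sum_centroidWeights_eq_one_of_nonempty ℝ hs)
  have hzT : z ∈ hull T₁ := h.facet₁.simplex.mem_hull_iff.2 fun i => by
    by_cases hi : i = i₀
    · rw [hi]; exact hz0.ge
    · exact (hzi i hi).le
  have hzF : z ∈ hull F := h.facet₁.mem_hull_facet hzT hz0
  have hcoord (i : T₁) (t : ℝ) : B.coord i (AffineMap.lineMap z a₂ t)
      = (1 - t) * B.coord i z + t * B.coord i a₂ := by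
    rw [AffineMap.apply_lineMap, AffineMap.lineMap_apply_module]
    simp
  -- For small `t > 0` the coordinates that are positive at `z` stay positive by continuity; the
  -- remaining one equals `t` times the height of `a₂`.
  have hev : ∀ᶠ t in nhdsWithin (0 : ℝ) (Ioi 0), ∀ i : T₁, 0 ≤ B.coord i (AffineMap.lineMap z a₂ t) := by
    refine Filter.eventually_all.2 fun i => ?_
    by_cases hi : i = i₀
    · filter_upwards [self_mem_nhdsWithin] with t ht
      rw [hcoord, hi, hz0, mul_zero, zero_add]
      exact mul_nonneg (le_of_lt ht) hpos.le
    · have hc : ContinuousAt (fun t : ℝ => B.coord i (AffineMap.lineMap z a₂ t)) 0 := by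
        simp only [hcoord]
        fun_prop
      have h0 : 0 < B.coord i (AffineMap.lineMap z a₂ (0 : ℝ)) := by simpa using hzi i hi
      filter_upwards [nhdsWithin_le_nhds (hc.eventually (lt_mem_nhds h0))] with t ht using ht.le
  have hev1 : ∀ᶠ t in nhdsWithin (0 : ℝ) (Ioi 0), t < 1 :=
    nhdsWithin_le_nhds (gt_mem_nhds one_pos)
  obtain ⟨t, ⟨ht, ht1⟩, ht0⟩ := ((hev.and hev1).and self_mem_nhdsWithin).exists
  have ht0' : (0 : ℝ) < t := ht0
  have hx2 : AffineMap.lineMap z a₂ t ∈ hull T₂ :=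
    (convex_hull T₂).lineMap_mem (hull_mono h.facet₂.sub hzF) (subset_hull h.facet₂.mem)
      ⟨ht0'.le, ht1.le⟩
  have hx := h.facet₁.height_of_mem_hull (h.inter ⟨h.facet₁.simplex.mem_hull_iff.2 ht, hx2⟩)
  change B.coord i₀ _ = 0 at hx
  rw [hcoord, hz0, mul_zero, zero_add] at hx
  exact (mul_pos ht0' hpos).ne' hx

variable {n y : Pt d} (hn : IsOutwardNormal T₁ F n) (hy : y ∈ F)
include hn hy

theorem isOutwardNormal_neg : IsOutwardNormal T₂ F (-n) := by
  refine ⟨by rw [norm_neg, hn.unit], fun x hx z hz => ?_, fun x hx hxF z hz => ?_⟩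
  · rw [inner_neg_left, hn.orthogonal x hx z hz, neg_zero]
  · obtain rfl := (h.facet₂.eq_or x hx).resolve_right hxF
    rw [inner_neg_left, neg_lt_zero]
    have h0 : 0 ≤ ⟪n, x - z⟫ := by
      rw [h.facet₁.inner_normal_eq hn hz]
      exact mul_nonneg_of_nonpos_of_nonpos (h.facet₁.inner_opposite_neg hn hz).le
        (h.height_nonpos ⟨y, hy⟩)
    -- Equality would make `n` orthogonal to `x - z` for every point `x`, in particular to itself.
    refine h0.lt_of_ne fun he => ?_
    have := h.facet₂.inner_eq (n := n) (fun v hv => hn.orthogonal v hv z hz) (n + z)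
    rw [← he, zero_mul, add_sub_cancel_right, real_inner_self_eq_norm_sq, hn.unit] at this
    norm_num at this

/-- A point of `T₂` on the side of `T₁` can only lie on the common facet. Hence, inside the patch,
`T₁` is exactly a half-space. -/
theorem mem_hull_left_iff {x : Pt d} (hx : x ∈ hull T₁ ∪ hull T₂) :
    x ∈ hull T₁ ↔ ⟪n, x - y⟫ ≤ 0 := by
  have h2 := h.isOutwardNormal_neg hn hy
  constructor
  · intro h1
    exact (h.facet₁.inner_normal_nonpos_iff hn hy x).2 (h.facet₁.height_nonneg h1)
  · intro hle
    rcases hx with hx | hx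
    · exact hx
    · have h3 := (h.facet₂.inner_normal_nonpos_iff h2 hy x).2 (h.facet₂.height_nonneg hx)
      rw [inner_neg_left] at h3
      have h4 := (h.facet₂.inner_normal_eq_zero_iff h2 hy x).1 (by rw [inner_neg_left]; linarith)
      exact hull_mono h.facet₁.sub (h.facet₂.mem_hull_facet hx h4)

theorem mem_hull_facet_iff {x : Pt d} (hx : x ∈ hull T₁ ∪ hull T₂) :
    x ∈ hull F ↔ ⟪n, x - y⟫ = 0 := by
  rw [h.facet₁.inner_normal_eq_zero_iff hn hy]
  refine ⟨h.facet₁.height_of_mem_hull, fun h0 => h.facet₁.mem_hull_facet ?_ h0⟩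
  rw [h.mem_hull_left_iff hn hy hx, h.facet₁.inner_normal_nonpos_iff hn hy, h0]

/-- The coordinates belonging to `F` are positive at `x` in both simplices and stay so nearby. The
sign of `⟪n, z - y⟫` then decides in which simplex `z` lies, since it controls the one remaining
coordinate. -/
theorem mem_interior_union {x : Pt d} (hx : x ∈ hull F)
    (h1 : ∀ i : T₁, (i : Pt d) ∈ F → h.facet₁.simplex.basis.coord i x ≠ 0)
    (h2 : ∀ i : T₂, (i : Pt d) ∈ F → h.facet₂.simplex.basis.coord i x ≠ 0) :
    x ∈ interior (hull T₁ ∪ hull T₂) := by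
  have hn2 := h.isOutwardNormal_neg hn hy
  have hev {T : Finset (Pt d)} (hT : IsSimplex T) (hFT : F ⊆ T)
      (h0 : ∀ i : T, (i : Pt d) ∈ F → hT.basis.coord i x ≠ 0) :
      ∀ᶠ z in nhds x, ∀ i : T, (i : Pt d) ∈ F → 0 ≤ hT.basis.coord i z := by
    refine Filter.eventually_all.2 fun i => ?_
    by_cases hi : (i : Pt d) ∈ F
    · have hpos : 0 < hT.basis.coord i x :=
        (hT.mem_hull_iff.1 (hull_mono hFT hx) i).lt_of_ne (h0 i hi).symm
      have hc : Continuous (hT.basis.coord i) :=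
        (hT.basis.coord i).continuous_of_finiteDimensional
      filter_upwards [hc.continuousAt.eventually (lt_mem_nhds hpos)] with z hz _ using hz.le
    · exact Filter.Eventually.of_forall fun z hi' => absurd hi' hi
  rw [mem_interior_iff_mem_nhds]
  filter_upwards [hev h.facet₁.simplex h.facet₁.sub h1, hev h.facet₂.simplex h.facet₂.sub h2]
    with z hz1 hz2
  rcases le_total ⟪n, z - y⟫ 0 with hle | hle
  · refine Or.inl (h.facet₁.simplex.mem_hull_iff.2 fun i => ?_)
    rcases h.facet₁.eq_or i i.2 with hi | hi
    · have := (h.facet₁.inner_normal_nonpos_iff hn hy z).1 hle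
      rwa [show i = ⟨a₁, h.facet₁.mem⟩ from Subtype.ext hi]
    · exact hz1 i hi
  · refine Or.inr (h.facet₂.simplex.mem_hull_iff.2 fun i => ?_)
    rcases h.facet₂.eq_or i i.2 with hi | hi
    · have := (h.facet₂.inner_normal_nonpos_iff hn2 hy z).1 (by rw [inner_neg_left]; linarith)
      rwa [show i = ⟨a₂, h.facet₂.mem⟩ from Subtype.ext hi]
    · exact hz2 i hi

end AreAdjacent

end Adjacent

/-! ### The surface measure on a facet -/

section Surface

variable {m : ℕ} {T F : Finset (Pt (m + 1))} {a n y : Pt (m + 1)}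

theorem faceMeasure_eq (F : Finset (Pt (m + 1))) :
    faceMeasure F = (Measure.euclideanHausdorffMeasure m).restrict (hull F) := rfl

/-- Pulled back to `ℝ^m`, the zero set is an affine subspace, proper because of `v`, hence Lebesgue
null. -/
theorem hyperplane_affine_zero_null (hn : ‖n‖ = 1) (f : Pt (m + 1) →ᵃ[ℝ] ℝ)
    {v : Pt (m + 1)} (hv : ⟪n, v - y⟫ = 0) (hfv : f v ≠ 0) :
    (Measure.euclideanHausdorffMeasure m).restrict {x | ⟪n, x - y⟫ = 0} {x | f x = 0} = 0 := by
  obtain ⟨b, rfl⟩ := exists_orthonormalBasis_zero hn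
  have hw := isometry_wallMap b y
  rw [← map_wallMap, hw.isClosedEmbedding.measurableEmbedding.map_apply]
  let A : Pt m →ᵃ[ℝ] ℝ := f.comp hw.affineIsometryOfStrictConvexSpace.toAffineMap
  have hA (s : Pt m) : A s = f (wallMap b y s) := rfl
  let S : AffineSubspace ℝ (Pt m) := (AffineSubspace.mk' (0 : ℝ) ⊥).comap A
  have hS (s : Pt m) : s ∈ S ↔ f (wallMap b y s) = 0 := by
    simp [S, hA, AffineSubspace.mem_mk']
  have hne : S ≠ ⊤ := by
    intro htop
    obtain ⟨s, rfl⟩ : v ∈ range (wallMap b y) := by rw [range_wallMap]; exact hv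
    exact hfv ((hS s).1 (htop ▸ AffineSubspace.mem_top ℝ _ s))
  convert Measure.addHaar_affineSubspace volume S hne using 2
  ext s
  exact (hS s).symm

variable (h : IsFacet T F a) (hn : IsOutwardNormal T F n) (hy : y ∈ F)
include h hn hy

theorem IsFacet.hull_subset_hyperplane : hull F ⊆ {x | ⟪n, x - y⟫ = 0} := fun x hx =>
  (h.inner_normal_eq_zero_iff hn hy x).2 (h.height_of_mem_hull hx)

theorem IsFacet.isFiniteMeasure_faceMeasure : IsFiniteMeasure (faceMeasure F) := by
  have hsub := h.hull_subset_hyperplane hn hy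
  obtain ⟨b, rfl⟩ := exists_orthonormalBasis_zero hn.unit
  have hw := isometry_wallMap b y
  refine ⟨?_⟩
  rw [faceMeasure_eq, ← Measure.restrict_restrict_of_subset hsub, ← map_wallMap,
    Measure.restrict_apply_univ, hw.isClosedEmbedding.measurableEmbedding.map_apply]
  exact (hw.isClosedEmbedding.isCompact_preimage (isCompact_hull F)).measure_lt_top

theorem IsFacet.faceMeasure_coord_zero (i : T) (hi : (i : Pt (m + 1)) ∈ F) :
    faceMeasure F {x | h.simplex.basis.coord i x = 0} = 0 := by
  rw [faceMeasure_eq, ← Measure.restrict_restrict_of_subset (h.hull_subset_hyperplane hn hy)]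
  refine Measure.restrict_le_self.absolutelyContinuous (hyperplane_affine_zero_null hn.unit _
    (hn.orthogonal _ hi y hy) (v := i) ?_)
  rw [← h.simplex.basis_apply i, h.simplex.basis.coord_apply_eq]
  exact one_ne_zero

end Surface

/-! ### Green's formula for fields supported in the patch of two adjacent simplices -/

section Adjacent

variable {m : ℕ} {T₁ T₂ F : Finset (Pt (m + 1))} {a₁ a₂ n y : Pt (m + 1)}
  (h : AreAdjacent T₁ T₂ F a₁ a₂) (hn : IsOutwardNormal T₁ F n) (hy : y ∈ F)
include h hn hy

/-- The exceptional points lie on the relative boundary of `F`, which is covered by finitely many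
zero sets of barycentric coordinates. -/
theorem AreAdjacent.ae_mem_interior :
    ∀ᵐ x ∂(faceMeasure F), x ∈ interior (hull T₁ ∪ hull T₂) := by
  have h1 : ∀ i : T₁, ∀ᵐ x ∂(faceMeasure F), (i : Pt (m + 1)) ∈ F →
      h.facet₁.simplex.basis.coord i x ≠ 0 := fun i => by
    by_cases hi : (i : Pt (m + 1)) ∈ F
    · have h0 := h.facet₁.faceMeasure_coord_zero hn hy i hi
      rw [measure_eq_zero_iff_ae_notMem] at h0
      filter_upwards [h0] with x hx _ using hx
    · exact ae_of_all _ fun x hi' => absurd hi' hi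
  have hn2 := h.isOutwardNormal_neg hn hy
  have h2 : ∀ i : T₂, ∀ᵐ x ∂(faceMeasure F), (i : Pt (m + 1)) ∈ F →
      h.facet₂.simplex.basis.coord i x ≠ 0 := fun i => by
    by_cases hi : (i : Pt (m + 1)) ∈ F
    · have h0 := h.facet₂.faceMeasure_coord_zero hn2 hy i hi
      rw [measure_eq_zero_iff_ae_notMem] at h0
      filter_upwards [h0] with x hx _ using hx
    · exact ae_of_all _ fun x hi' => absurd hi' hi
  have hF : ∀ᵐ x ∂(faceMeasure F), x ∈ hull F := ae_restrict_mem (measurableSet_hull F)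
  filter_upwards [ae_all_iff.2 h1, ae_all_iff.2 h2, hF] with x hx1 hx2 hxF
  exact h.mem_interior_union hn hy hxF hx1 hx2

/-- On the support of `σ` the element coincides with a half-space and the facet with its bounding
hyperplane, so the other facets never enter. -/
theorem AreAdjacent.integral_divergence {σ : Pt (m + 1) → Pt (m + 1)} (hσ : ContDiff ℝ 1 σ)
    (hc : HasCompactSupport σ) (hs : tsupport σ ⊆ interior (hull T₁ ∪ hull T₂)) :
    ∫ x in hull T₁, divergence σ x = ∫ x, ⟪n, σ x⟫ ∂(faceMeasure F) := by
  have key := setIntegral_halfSpace_divergence hn.unit y hσ hc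
  have m1 : MeasurableSet {x | ⟪n, x - y⟫ ≤ 0} :=
    (isClosed_le (by fun_prop) continuous_const).measurableSet
  have m2 : MeasurableSet {x | ⟪n, x - y⟫ = 0} :=
    (isClosed_eq (by fun_prop) continuous_const).measurableSet
  have hmem {x : Pt (m + 1)} (hx : x ∈ tsupport σ) : x ∈ hull T₁ ∪ hull T₂ :=
    interior_subset (hs hx)
  rw [faceMeasure_eq, ← integral_indicator (measurableSet_hull _),
    ← integral_indicator (measurableSet_hull _)]
  rw [← integral_indicator m1, ← integral_indicator m2] at key
  convert key using 2
  · ext x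
    by_cases hx : x ∈ tsupport σ
    · simp only [indicator, h.mem_hull_left_iff hn hy (hmem hx)]
      rfl
    · have h0 : divergence σ x = 0 := by
        by_contra h0; exact hx (support_divergence_subset h0)
      simp [indicator, h0]
  · ext x
    by_cases hx : x ∈ tsupport σ
    · simp only [indicator, h.mem_hull_facet_iff hn hy (hmem hx)]
      rfl
    · simp [indicator, image_eq_zero_of_notMem_tsupport hx]

end Adjacent

/-! ### Meshes and elements -/

section Mesh

variable {d : ℕ} {Ω : Set (Pt d)} {M : Mesh Ω} {T T₁ T₂ F : Finset (Pt d)}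

theorem Mesh.isSimplex (hT : T ∈ M.elements) : IsSimplex T := by
  simp only [Mesh.elements, Finset.mem_filter, Finite.mem_toFinset] at hT
  exact ⟨M.complex.indep hT.1, hT.2⟩

theorem Mesh.hull_subset (hT : T ∈ M.elements) : hull T ⊆ closure Ω := by
  simp only [Mesh.elements, Finset.mem_filter, Finite.mem_toFinset] at hT
  rw [← M.cover]
  exact Geometry.SimplicialComplex.convexHull_subset_space hT.1

theorem Mesh.interior_hull_subset (hΩ : IsPolyhedralDomain Ω) (hT : T ∈ M.elements) :
    interior (hull T) ⊆ Ω :=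
  (interior_mono (Mesh.hull_subset hT)).trans hΩ.regular.subset

/-- This is where the absence of cracks matters: the interior of the patch contains almost all of
the common face and lies in `Ω`, so `u` and `q` have weak derivatives across the face. -/
theorem Mesh.interior_union_subset (hΩ : IsPolyhedralDomain Ω) (h₁ : T₁ ∈ M.elements)
    (h₂ : T₂ ∈ M.elements) : interior (hull T₁ ∪ hull T₂) ⊆ Ω :=
  (interior_mono (union_subset (Mesh.hull_subset h₁) (Mesh.hull_subset h₂))).trans
    hΩ.regular.subset

/-- Distinct elements share at most `d` vertices, so `F` is their whole set of common vertices, and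
conformity says that the simplices meet in its hull. -/
theorem Mesh.exists_areAdjacent (hF : F ∈ M.faces) (h₁ : T₁ ∈ M.elements) (h₂ : T₂ ∈ M.elements)
    (hne : T₁ ≠ T₂) (hF₁ : F ⊆ T₁) (hF₂ : F ⊆ T₂) : ∃ a₁ a₂, AreAdjacent T₁ T₂ F a₁ a₂ := by
  classical
  have s₁ := Mesh.isSimplex h₁
  have s₂ := Mesh.isSimplex h₂
  simp only [Mesh.faces, Mesh.elements, Finset.mem_filter, Finite.mem_toFinset] at hF h₁ h₂
  obtain ⟨a₁, f₁⟩ := s₁.exists_isFacet hF₁ hF.2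
  obtain ⟨a₂, f₂⟩ := s₂.exists_isFacet hF₂ hF.2
  refine ⟨a₁, a₂, f₁, f₂, ?_⟩
  have hlt : (T₁ ∩ T₂).card < d + 1 := by
    rw [← s₁.card]
    refine Finset.card_lt_card (Finset.inter_subset_left.ssubset_of_ne fun he => hne ?_)
    exact Finset.eq_of_subset_of_card_le (Finset.inter_eq_left.1 he) (by rw [s₁.card, s₂.card])
  have heq : F = T₁ ∩ T₂ :=
    Finset.eq_of_subset_of_card_le (Finset.subset_inter hF₁ hF₂) (by rw [hF.2]; omega)
  have := M.complex.inter_subset_convexHull h₁.1 h₂.1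
  rw [← Finset.coe_inter, ← heq] at this
  exact this

theorem frontier_hull_null (T : Finset (Pt d)) : volume (frontier (hull T)) = 0 :=
  (convex_hull T).addHaar_frontier volume

/-- Norms are taken over closed simplices but weak derivatives over their interiors; the boundary of
a convex set is null, so the two match. -/
theorem elemMeasure_eq (T : Finset (Pt d)) :
    elemMeasure T = volume.restrict (interior (hull T)) :=
  (Measure.restrict_congr_set (interior_ae_eq_of_null_frontier (frontier_hull_null T))).symm

instance (T : Finset (Pt d)) : IsFiniteMeasure (elemMeasure T) :=
  ⟨by rw [elemMeasure, Measure.restrict_apply_univ]; exact (isCompact_hull T).measure_lt_top⟩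

theorem IsFacet.hull_subset_frontier {a : Pt d} (h : IsFacet T F a) :
    hull F ⊆ frontier (hull T) := by
  intro x hx
  refine ⟨subset_closure (hull_mono h.sub hx), fun hi => ?_⟩
  have hr : range h.simplex.basis = (T : Set (Pt d)) := Subtype.range_coe
  rw [hull, ← hr, h.simplex.basis.interior_convexHull] at hi
  exact (hi ⟨a, h.mem⟩).ne' (h.height_of_mem_hull hx)

theorem AreAdjacent.aedisjoint {a₁ a₂ : Pt d} (h : AreAdjacent T₁ T₂ F a₁ a₂) :
    AEDisjoint volume (hull T₁) (hull T₂) :=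
  measure_mono_null (h.inter.trans h.facet₁.hull_subset_frontier) (frontier_hull_null T₁)

theorem memLp_restrict_of_continuousOn {E : Type} [NormedAddCommGroup E]
    {μ : Measure (Pt d)} {K : Set (Pt d)} (hK : IsCompact K) [IsFiniteMeasure (μ.restrict K)]
    {f : Pt d → E} (hf : ContinuousOn f K) {r : ENNReal} : MemLp f r (μ.restrict K) := by
  obtain ⟨C, hC⟩ := hK.exists_bound_of_continuousOn hf
  refine MemLp.of_bound (hf.aestronglyMeasurable_of_isCompact hK hK.measurableSet) C ?_
  filter_upwards [ae_restrict_mem hK.measurableSet] with x hx using hC x hx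

end Mesh

/-! ### Elementwise Green formulas -/

section Green

variable {d : ℕ} {T : Finset (Pt d)} {U : Set (Pt d)}

theorem IsTest.divergence {Φ : Pt d → Pt d} (hΦ : IsTest U Φ) :
    IsTest U (HDG.divergence Φ) := by
  have h := hΦ.fderiv.clm_comp (∑ i, (coordL i).comp
    (ContinuousLinearMap.apply ℝ (Pt d) (EuclideanSpace.single i (1 : ℝ))))
  have e : HDG.divergence Φ = fun x => (∑ i, (coordL i).comp
      (ContinuousLinearMap.apply ℝ (Pt d) (EuclideanSpace.single i (1 : ℝ))))
        (_root_.fderiv ℝ Φ x) := by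
    ext x; simp [HDG.divergence]
  rw [e]
  exact h

theorem IsTest.integrable_green {u : Pt d → ℝ} {A Φ : Pt d → Pt d} (hΦ : IsTest U Φ)
    (hu : IsWeakGrad U u A) :
    Integrable fun x => u x * HDG.divergence Φ x + ⟪A x, Φ x⟫ := by
  refine Integrable.add ?_ (hΦ.integrable_inner hu.locInt_grad)
  simpa [mul_comm] using hΦ.divergence.integrable_smul hu.locInt

theorem IsTest.integrable_green_div {q : Pt d → Pt d} {φ D : Pt d → ℝ} (hφ : IsTest U φ)
    (hq : IsWeakDiv U q D) : Integrable fun x => _root_.fderiv ℝ φ x (q x) + D x * φ x := by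
  refine (hφ.integrable_fderiv hq.locInt).add ?_
  simpa [mul_comm] using hφ.integrable_smul hq.locInt_div

theorem IsWeakDiv.parts_add {q : Pt d → Pt d} {φ D : Pt d → ℝ} (hq : IsWeakDiv U q D)
    (hφ : IsTest U φ) : ∫ x in U, (fderiv ℝ φ x (q x) + D x * φ x) = 0 := by
  have hi : Integrable fun x => D x * φ x := by
    simpa [mul_comm] using hφ.integrable_smul hq.locInt_div
  rw [integral_add (hφ.integrable_fderiv hq.locInt).integrableOn hi.integrableOn, hq.parts φ hφ]
  ring

theorem weakGrad_sub_ae_eq {u w : Pt d → ℝ} {A : Pt d → Pt d} (hT : interior (hull T) ⊆ U)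
    (hu : IsWeakGrad U u A) (hw : ContDiff ℝ 1 w) :
    weakGrad (interior (hull T)) (fun x => u x - w x) =ᵐ[elemMeasure T]
      fun x => A x - gradient w x := by
  rw [elemMeasure_eq]
  exact ((hu.mono hT).sub (isWeakGrad_gradient hw)).weakGrad_ae_eq isOpen_interior

theorem weakDiv_sub_ae_eq {q σ : Pt d → Pt d} {D : Pt d → ℝ} (hT : interior (hull T) ⊆ U)
    (hq : IsWeakDiv U q D) (hσ : ContDiff ℝ 1 σ) :
    weakDiv (interior (hull T)) (fun x => q x - σ x) =ᵐ[elemMeasure T]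
      fun x => D x - divergence σ x := by
  rw [elemMeasure_eq]
  exact ((hq.mono hT).sub (isWeakDiv_divergence hσ)).weakDiv_ae_eq isOpen_interior

/-- This splits off the smooth part as a total divergence, ready for the divergence theorem; the
`u`-part keeps a gradient `A` that does not depend on the element, so that two elements can be
added. -/
theorem setIntegral_sub_grad (hT : interior (hull T) ⊆ U)
    {u w : Pt d → ℝ} {A : Pt d → Pt d} (hu : IsWeakGrad U u A)
    (hw : ContDiff ℝ 1 w) {Φ : Pt d → Pt d} (hΦ : IsTest U Φ) :
    ∫ x in hull T, ((u x - w x) * divergence Φ x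
        + ⟪weakGrad (interior (hull T)) (fun x => u x - w x) x, Φ x⟫)
      = (∫ x in hull T, (u x * divergence Φ x + ⟪A x, Φ x⟫))
        - ∫ x in hull T, divergence (fun x => w x • Φ x) x := by
  have hdiv (x : Pt d) : divergence (fun x => w x • Φ x) x
      = w x * divergence Φ x + ⟪gradient w x, Φ x⟫ := by
    rw [divergence_smul (hw.differentiable (by simp) x) (hΦ.differentiable x), inner_gradient_left]
  simp only [hdiv]
  rw [← integral_sub (hΦ.integrable_green hu).integrableOn
    (hΦ.integrable_green (isWeakGrad_gradient hw)).integrableOn]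
  refine integral_congr_ae ?_
  filter_upwards [weakGrad_sub_ae_eq hT hu hw] with x hx
  rw [hx, inner_sub_left]
  ring

theorem setIntegral_sub_div (hT : interior (hull T) ⊆ U)
    {q σ : Pt d → Pt d} {D : Pt d → ℝ} (hq : IsWeakDiv U q D)
    (hσ : ContDiff ℝ 1 σ) {φ : Pt d → ℝ} (hφ : IsTest U φ) :
    ∫ x in hull T, (fderiv ℝ φ x (q x - σ x)
        + weakDiv (interior (hull T)) (fun x => q x - σ x) x * φ x)
      = (∫ x in hull T, (fderiv ℝ φ x (q x) + D x * φ x))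
        - ∫ x in hull T, divergence (fun x => φ x • σ x) x := by
  have hdiv (x : Pt d) : divergence (fun x => φ x • σ x) x
      = fderiv ℝ φ x (σ x) + divergence σ x * φ x := by
    rw [divergence_smul (hφ.differentiable x) (hσ.differentiable (by simp) x)]
    ring
  simp only [hdiv]
  rw [← integral_sub (hφ.integrable_green_div hq).integrableOn
    (hφ.integrable_green_div (isWeakDiv_divergence hσ)).integrableOn]
  refine integral_congr_ae ?_
  filter_upwards [weakDiv_sub_ae_eq hT hq hσ] with x hx
  rw [hx, map_sub]
  ring

end Green

/-! ### Jumps across a facet -/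

section Jump

variable {m : ℕ} {T₁ T₂ F : Finset (Pt (m + 1))} {a₁ a₂ y : Pt (m + 1)}

theorem normSq_neg_congr {d : ℕ} {μ : Measure (Pt d)} {f g : Pt d → ℝ}
    (h : f =ᵐ[μ] fun x => -g x) : normSq μ f = normSq μ g := by
  refine integral_congr_ae ?_
  filter_upwards [h] with x hx
  rw [hx, norm_neg]

theorem setIntegral_union_hull (h : AreAdjacent T₁ T₂ F a₁ a₂)
    {f : Pt (m + 1) → ℝ} (hf : Integrable f)
    (h0 : ∀ x, x ∉ interior (hull T₁ ∪ hull T₂) → f x = 0) :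
    (∫ x in hull T₁, f x) + ∫ x in hull T₂, f x = ∫ x in interior (hull T₁ ∪ hull T₂), f x := by
  rw [← setIntegral_union₀ h.aedisjoint (measurableSet_hull T₂).nullMeasurableSet
    hf.integrableOn hf.integrableOn, setIntegral_eq_integral_of_forall_compl_eq_zero h0,
    setIntegral_eq_integral_of_forall_compl_eq_zero fun x hx => h0 x fun hi => hx (interior_subset hi)]

variable (h : AreAdjacent T₁ T₂ F a₁ a₂) (hy : y ∈ F)
include h hy

theorem AreAdjacent.isOutwardNormal : IsOutwardNormal T₁ F (normal T₁ F) :=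
  h.facet₁.isOutwardNormal_normal ⟨y, hy⟩

theorem AreAdjacent.normal_right : normal T₂ F = -normal T₁ F :=
  h.facet₂.normal_unique (h.symm.isOutwardNormal hy) hy
    (h.isOutwardNormal_neg (h.isOutwardNormal hy) hy)

theorem AreAdjacent.isFiniteMeasure : IsFiniteMeasure (faceMeasure F) :=
  h.facet₁.isFiniteMeasure_faceMeasure (h.isOutwardNormal hy) hy

theorem AreAdjacent.memLp {J : Pt (m + 1) → ℝ} (hJ : Continuous J) :
    MemLp J 2 (faceMeasure F) := by
  have : IsFiniteMeasure ((Measure.euclideanHausdorffMeasure m).restrict (hull F)) :=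
    h.isFiniteMeasure hy
  rw [faceMeasure_eq]
  exact memLp_restrict_of_continuousOn (isCompact_hull F) hJ.continuousOn

theorem AreAdjacent.locallyIntegrableOn {J : Pt (m + 1) → ℝ} (hJ : MemLp J 2 (faceMeasure F))
    (U : Set (Pt (m + 1))) : LocallyIntegrableOn J U (faceMeasure F) := by
  have := h.isFiniteMeasure hy
  exact (hJ.integrable (by simp)).locallyIntegrable.locallyIntegrableOn U

theorem AreAdjacent.integrable_face {J : Pt (m + 1) → ℝ} (hJ : Continuous J) :
    Integrable J (faceMeasure F) := by
  have := h.isFiniteMeasure hy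
  exact (h.memLp hy hJ).integrable (by simp)

/-- Testing with `Φ = φ n` turns Green's formula into `∫ J φ`, as `n` has norm one. -/
theorem IsJump.ae_eq {w : Finset (Pt (m + 1)) → Pt (m + 1) → ℝ} {J J' : Pt (m + 1) → ℝ}
    (hJ : IsJump T₁ T₂ F w J) (hJ' : IsJump T₁ T₂ F w J') : J =ᵐ[faceMeasure F] J' := by
  have hn := h.isOutwardNormal hy
  have key := ae_eq_of_integral_test isOpen_interior
    (h.locallyIntegrableOn hy hJ.memLp (interior (hull T₁ ∪ hull T₂)))
    (h.locallyIntegrableOn hy hJ'.memLp _) fun φ hφ => by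
      have e := (hJ.green _ (hφ.smul_const (normal T₁ F))).symm.trans
        (hJ'.green _ (hφ.smul_const (normal T₁ F)))
      simpa [inner_smul_right, real_inner_self_eq_norm_sq, hn.unit, mul_comm] using e
  filter_upwards [key, h.ae_mem_interior hn hy] with x hx hxU using hx hxU

theorem IsNormalJump.ae_eq {σ : Finset (Pt (m + 1)) → Pt (m + 1) → Pt (m + 1)}
    {J J' : Pt (m + 1) → ℝ} (hJ : IsNormalJump T₁ T₂ F σ J) (hJ' : IsNormalJump T₁ T₂ F σ J') :
    J =ᵐ[faceMeasure F] J' := by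
  have hn := h.isOutwardNormal hy
  have key := ae_eq_of_integral_test isOpen_interior
    (h.locallyIntegrableOn hy hJ.memLp (interior (hull T₁ ∪ hull T₂)))
    (h.locallyIntegrableOn hy hJ'.memLp _) fun φ hφ => by
      have e := (hJ.green _ hφ).symm.trans (hJ'.green _ hφ)
      simpa [mul_comm] using e
  filter_upwards [key, h.ae_mem_interior hn hy] with x hx hxU using hx hxU

/-- The `u`-parts on the two elements add up to the weak gradient identity on the patch, which is
zero. The total divergences of `w T₁ Φ` and `w T₂ Φ` give face integrals with opposite normals, that
is, the jump. -/
theorem isJump_sub {u : Pt (m + 1) → ℝ} {A : Pt (m + 1) → Pt (m + 1)}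
    (hu : IsWeakGrad (interior (hull T₁ ∪ hull T₂)) u A)
    {w : Finset (Pt (m + 1)) → Pt (m + 1) → ℝ} (hw₁ : ContDiff ℝ 1 (w T₁))
    (hw₂ : ContDiff ℝ 1 (w T₂)) :
    IsJump T₁ T₂ F (fun T x => u x - w T x) fun x => -(w T₁ x - w T₂ x) := by
  have hn := h.isOutwardNormal hy
  have hn₂ := h.isOutwardNormal_neg hn hy
  refine ⟨h.memLp hy (hw₁.continuous.sub hw₂.continuous).neg, fun Φ hΦ => ?_⟩
  have hΦ1 : ContDiff ℝ 1 Φ := hΦ.smooth.of_le (by simp)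
  have hint := hΦ.integrable_green hu
  have hs (w : Pt (m + 1) → ℝ) (hw : ContDiff ℝ 1 w) : ContDiff ℝ 1 fun x => w x • Φ x :=
    hw.smul hΦ1
  have hc (w : Pt (m + 1) → ℝ) : HasCompactSupport fun x => w x • Φ x :=
    HasCompactSupport.intro hΦ.compact fun x hx => by
      rw [image_eq_zero_of_notMem_tsupport hx, smul_zero]
  have ht (w : Pt (m + 1) → ℝ) : tsupport (fun x => w x • Φ x)
      ⊆ interior (hull T₁ ∪ hull T₂) :=
    (closure_mono (Function.support_smul_subset_right w Φ)).trans hΦ.support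
  have ht' : tsupport (fun x => w T₂ x • Φ x) ⊆ interior (hull T₂ ∪ hull T₁) := by
    rw [union_comm]; exact ht _
  rw [setIntegral_sub_grad (interior_mono subset_union_left) hu hw₁ hΦ,
    setIntegral_sub_grad (interior_mono subset_union_right) hu hw₂ hΦ,
    h.integral_divergence hn hy (hs _ hw₁) (hc _) (ht _),
    h.symm.integral_divergence hn₂ hy (hs _ hw₂) (hc _) ht']
  have hz (x : Pt (m + 1)) (hx : x ∉ interior (hull T₁ ∪ hull T₂)) :
      u x * divergence Φ x + ⟪A x, Φ x⟫ = 0 := by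
    rw [hΦ.eq_zero hx, hΦ.divergence_eq_zero hx, mul_zero, inner_zero_right, add_zero]
  have h0 := (setIntegral_union_hull h hint hz).trans (hu.parts_vector hΦ)
  have e : ∫ x, -(w T₁ x - w T₂ x) * ⟪normal T₁ F, Φ x⟫ ∂(faceMeasure F)
      = -(∫ x, ⟪normal T₁ F, w T₁ x • Φ x⟫ ∂(faceMeasure F))
        - ∫ x, ⟪-normal T₁ F, w T₂ x • Φ x⟫ ∂(faceMeasure F) := by
    rw [← integral_neg, ← integral_sub]
    · refine integral_congr_ae (ae_of_all _ fun x => ?_)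
      simp only [inner_smul_right, inner_neg_left]
      ring
    · exact (h.integrable_face hy (continuous_const.inner (hs _ hw₁).continuous)).neg
    · exact h.integrable_face hy (continuous_const.inner (hs _ hw₂).continuous)
  rw [e]
  linarith

/-- Same cancellation, with a scalar test function multiplying the field; the two outward normals
already carry the opposite signs. -/
theorem isNormalJump_sub {q : Pt (m + 1) → Pt (m + 1)} {D : Pt (m + 1) → ℝ}
    (hq : IsWeakDiv (interior (hull T₁ ∪ hull T₂)) q D)
    {σ : Finset (Pt (m + 1)) → Pt (m + 1) → Pt (m + 1)} (hσ₁ : ContDiff ℝ 1 (σ T₁))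
    (hσ₂ : ContDiff ℝ 1 (σ T₂)) :
    IsNormalJump T₁ T₂ F (fun T x => q x - σ T x)
      fun x => -(⟪σ T₁ x, normal T₁ F⟫ + ⟪σ T₂ x, normal T₂ F⟫) := by
  have hn := h.isOutwardNormal hy
  have hn₂ := h.isOutwardNormal_neg hn hy
  rw [h.normal_right hy]
  refine ⟨h.memLp hy ((hσ₁.continuous.inner continuous_const).add
    (hσ₂.continuous.inner continuous_const)).neg, fun φ hφ => ?_⟩
  have hφ1 : ContDiff ℝ 1 φ := hφ.smooth.of_le (by simp)
  have hint := hφ.integrable_green_div hq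
  have hs (σ : Pt (m + 1) → Pt (m + 1)) (hσ : ContDiff ℝ 1 σ) :
      ContDiff ℝ 1 fun x => φ x • σ x :=
    hφ1.smul hσ
  have hc (σ : Pt (m + 1) → Pt (m + 1)) : HasCompactSupport fun x => φ x • σ x :=
    hφ.compact.smul_right
  have ht (σ : Pt (m + 1) → Pt (m + 1)) : tsupport (fun x => φ x • σ x)
      ⊆ interior (hull T₁ ∪ hull T₂) :=
    (closure_mono (Function.support_smul_subset_left φ σ)).trans hφ.support
  have ht' : tsupport (fun x => φ x • σ T₂ x) ⊆ interior (hull T₂ ∪ hull T₁) := by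
    rw [union_comm]; exact ht _
  rw [setIntegral_sub_div (interior_mono subset_union_left) hq hσ₁ hφ,
    setIntegral_sub_div (interior_mono subset_union_right) hq hσ₂ hφ,
    h.integral_divergence hn hy (hs _ hσ₁) (hc _) (ht _),
    h.symm.integral_divergence hn₂ hy (hs _ hσ₂) (hc _) ht']
  have hz (x : Pt (m + 1)) (hx : x ∉ interior (hull T₁ ∪ hull T₂)) :
      fderiv ℝ φ x (q x) + D x * φ x = 0 := by
    simp [hφ.eq_zero hx, hφ.fderiv_eq_zero hx]
  have h0 := (setIntegral_union_hull h hint hz).trans (hq.parts_add hφ)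
  have e : ∫ x, -(⟪σ T₁ x, normal T₁ F⟫ + ⟪σ T₂ x, -normal T₁ F⟫) * φ x ∂(faceMeasure F)
      = -(∫ x, ⟪normal T₁ F, φ x • σ T₁ x⟫ ∂(faceMeasure F))
        - ∫ x, ⟪-normal T₁ F, φ x • σ T₂ x⟫ ∂(faceMeasure F) := by
    rw [← integral_neg, ← integral_sub]
    · refine integral_congr_ae (ae_of_all _ fun x => ?_)
      simp only [inner_smul_right, real_inner_comm]
      ring
    · exact (h.integrable_face hy (continuous_const.inner (hs _ hσ₁).continuous)).neg
    · exact h.integrable_face hy (continuous_const.inner (hs _ hσ₂).continuous)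
  rw [e]
  linarith

theorem jump_sub_ae_eq {u : Pt (m + 1) → ℝ} {A : Pt (m + 1) → Pt (m + 1)}
    (hu : IsWeakGrad (interior (hull T₁ ∪ hull T₂)) u A)
    {w : Finset (Pt (m + 1)) → Pt (m + 1) → ℝ} (hw₁ : ContDiff ℝ 1 (w T₁))
    (hw₂ : ContDiff ℝ 1 (w T₂)) :
    jump T₁ T₂ F (fun T x => u x - w T x) =ᵐ[faceMeasure F] fun x => -(w T₁ x - w T₂ x) := by
  have hJ := isJump_sub h hy hu hw₁ hw₂
  have hex : ∃ J, IsJump T₁ T₂ F (fun T x => u x - w T x) J := ⟨_, hJ⟩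
  rw [jump, dif_pos hex]
  exact IsJump.ae_eq h hy hex.choose_spec hJ

theorem normalJump_sub_ae_eq {q : Pt (m + 1) → Pt (m + 1)} {D : Pt (m + 1) → ℝ}
    (hq : IsWeakDiv (interior (hull T₁ ∪ hull T₂)) q D)
    {σ : Finset (Pt (m + 1)) → Pt (m + 1) → Pt (m + 1)} (hσ₁ : ContDiff ℝ 1 (σ T₁))
    (hσ₂ : ContDiff ℝ 1 (σ T₂)) :
    normalJump T₁ T₂ F (fun T x => q x - σ T x) =ᵐ[faceMeasure F]
      fun x => -(⟪σ T₁ x, normal T₁ F⟫ + ⟪σ T₂ x, normal T₂ F⟫) := by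
  have hJ := isNormalJump_sub h hy hq hσ₁ hσ₂
  have hex : ∃ J, IsNormalJump T₁ T₂ F (fun T x => q x - σ T x) J := ⟨_, hJ⟩
  rw [normalJump, dif_pos hex]
  exact IsNormalJump.ae_eq h hy hex.choose_spec hJ

end Jump

/-! ### Efficiency of the estimator -/

section Efficiency

variable {d : ℕ}

theorem gamma_nonneg {ε : ℝ} (hε : 0 < ε) (β : Pt d → Pt d) (F : Finset (Pt d)) :
    0 ≤ gamma ε β F := by
  have h1 : 0 ≤ size F := Metric.diam_nonneg
  have h2 : 0 ≤ supNorm β F := ENNReal.toReal_nonneg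
  have h3 : 0 ≤ ε ^ (-(1 / 2) : ℝ) := Real.rpow_nonneg hε.le _
  have h4 : 0 ≤ alpha ε F := le_min (mul_nonneg h1 h3) zero_le_one
  exact le_min (by positivity) (by positivity)

theorem alpha_nonneg {ε : ℝ} (hε : 0 < ε) (S : Finset (Pt d)) : 0 ≤ alpha ε S :=
  le_min (mul_nonneg Metric.diam_nonneg (Real.rpow_nonneg hε.le _)) zero_le_one

theorem normSq_nonneg {G : Type} [NormedAddCommGroup G] (μ : Measure (Pt d)) (w : Pt d → G) :
    0 ≤ normSq μ w :=
  integral_nonneg fun _ => by positivity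

theorem oscSq_nonneg {Ω : Set (Pt d)} (M : Mesh Ω) (p : ℕ) (ε : ℝ)
    (R : Finset (Pt d) → Pt d → ℝ) (T : Finset (Pt d)) : 0 ≤ oscSq M p ε R T :=
  mul_nonneg (sq_nonneg _) (normSq_nonneg _ _)

/-- If `‖f‖ ≤ a ‖g‖ + b ‖k‖` almost everywhere, then `‖f‖² ≤ 2 a² ‖g‖² + 2 b² ‖k‖²` in `L²`. -/
theorem normSq_le_of_norm_le {G₁ G₂ G₃ : Type} [NormedAddCommGroup G₁] [NormedAddCommGroup G₂]
    [NormedAddCommGroup G₃] {μ : Measure (Pt d)} {f : Pt d → G₁} {g : Pt d → G₂} {k : Pt d → G₃}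
    (hg : MemLp g 2 μ) (hk : MemLp k 2 μ) {a b : ℝ}
    (h : ∀ᵐ x ∂μ, ‖f x‖ ≤ a * ‖g x‖ + b * ‖k x‖) :
    normSq μ f ≤ 2 * a ^ 2 * normSq μ g + 2 * b ^ 2 * normSq μ k := by
  have ig : Integrable (fun x => ‖g x‖ ^ 2) μ := (memLp_two_iff_integrable_sq_norm hg.1).1 hg
  have ik : Integrable (fun x => ‖k x‖ ^ 2) μ := (memLp_two_iff_integrable_sq_norm hk.1).1 hk
  unfold normSq
  rw [← integral_const_mul, ← integral_const_mul,
    ← integral_add (ig.const_mul _) (ik.const_mul _)]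
  refine integral_mono_of_nonneg (ae_of_all _ fun _ => by positivity)
    ((ig.const_mul _).add (ik.const_mul _)) ?_
  filter_upwards [h] with x hx
  have h1 : ‖f x‖ ^ 2 ≤ (a * ‖g x‖ + b * ‖k x‖) ^ 2 := pow_le_pow_left₀ (norm_nonneg _) hx 2
  nlinarith [sq_nonneg (a * ‖g x‖ - b * ‖k x‖)]

theorem etaBoundary_eq {ε : ℝ} (hε : 0 < ε) (β : Pt d → Pt d) (g : Pt d → ℝ)
    (uh : Finset (Pt d) → Pt d → ℝ) (T F : Finset (Pt d)) :
    etaBoundary ε β g uh T F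
      = √(gamma ε β F * normSq (faceMeasure F) (fun x => g x - uh T x)) := by
  rw [etaBoundary, Real.sqrt_mul (gamma_nonneg hε β F)]
  simp only [normSq, norm_sub_rev]

/-- The jumps of the errors are minus the jumps of the discrete solution almost everywhere, and the
sign disappears in the norm. -/
theorem etaInterior_eq {m : ℕ} {Ω : Set (Pt (m + 1))} (hΩ : IsPolyhedralDomain Ω) {M : Mesh Ω}
    {ε : ℝ} (β : Pt (m + 1) → Pt (m + 1)) {q : Pt (m + 1) → Pt (m + 1)} {u : Pt (m + 1) → ℝ}
    (hu : MemH1 Ω u) (hq : MemHdiv Ω q) {qh : Finset (Pt (m + 1)) → Pt (m + 1) → Pt (m + 1)}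
    {uh : Finset (Pt (m + 1)) → Pt (m + 1) → ℝ} {p : ℕ} (hqh : MemV M p qh) (huh : MemW M p uh)
    {T₁ T₂ F : Finset (Pt (m + 1))} (hF : F ∈ M.faces) (h₁ : T₁ ∈ M.elements)
    (h₂ : T₂ ∈ M.elements) (hne : T₁ ≠ T₂) (hF₁ : F ⊆ T₁) (hF₂ : F ⊆ T₂) :
    etaInterior ε β qh uh T₁ T₂ F
      = √(ε ^ (-(1 / 2) : ℝ) * alpha ε F
            * normSq (faceMeasure F) (normalJump T₁ T₂ F (fun T x => q x - qh T x))
          + gamma ε β F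
            * normSq (faceMeasure F) (jump T₁ T₂ F (fun T x => u x - uh T x))) := by
  obtain ⟨a₁, a₂, h⟩ := Mesh.exists_areAdjacent hF h₁ h₂ hne hF₁ hF₂
  obtain ⟨y, hy⟩ : F.Nonempty := by
    rw [← Finset.card_pos, (Finset.mem_filter.1 hF).2]
    omega
  have hsub := Mesh.interior_union_subset hΩ h₁ h₂
  obtain ⟨-, A, hA, -⟩ := hu
  obtain ⟨-, D, hD, -⟩ := hq
  rw [etaInterior,
    normSq_neg_congr (normalJump_sub_ae_eq h hy (hD.mono hsub) (contDiff_of_isPoly (hqh T₁ h₁))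
      (contDiff_of_isPoly (hqh T₂ h₂))),
    normSq_neg_congr (jump_sub_ae_eq h hy (hA.mono hsub) (huh T₁ h₁).contDiff
      (huh T₂ h₂).contDiff)]

variable {Ω : Set (Pt d)}

theorem etaElem_le (hΩ : IsPolyhedralDomain Ω) {M : Mesh Ω} {β : Pt d → Pt d} {c f g : Pt d → ℝ}
    (hβ : ContinuousOn β (closure Ω)) (hc : MemLp c ⊤ (volume.restrict Ω)) {ε : ℝ} (hε : 0 < ε)
    {q : Pt d → Pt d} {u : Pt d → ℝ}
    (hqu : IsExactSolution M ε β c f g q u)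
    {qh : Finset (Pt d) → Pt d → Pt d} {uh : Finset (Pt d) → Pt d → ℝ} {p : ℕ}
    (hqh : MemV M p qh) (huh : MemW M p uh) {T : Finset (Pt d)} (hT : T ∈ M.elements) :
    etaElem ε β c f qh uh T ≤
      √(2 + 2 * (eLpNorm c ⊤ (volume.restrict Ω)).toReal ^ 2)
        * √(ε⁻¹ * normSq (elemMeasure T) (fun x => q x - qh T x)
            + normSq (elemMeasure T) (fun x => u x - uh T x)
            + ε * normSq (elemMeasure T)
                (weakGrad (interior (hull T)) (fun x => u x - uh T x))
            + alpha ε T ^ 2 * normSq (elemMeasure T)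
                (fun x => weakDiv (interior (hull T)) (fun y => q y - qh T y) x
                  + ⟪β x, weakGrad (interior (hull T)) (fun y => u y - uh T y) x⟫)
            + oscSq M p ε (residual β c f qh uh) T) := by
  have hsub := Mesh.interior_hull_subset hΩ hT
  -- Every almost-everywhere identity and every `L²` bound on `Ω` restricts to the element through
  -- this inequality.
  have hle : elemMeasure T ≤ volume.restrict Ω := by
    rw [elemMeasure_eq]; exact Measure.restrict_mono hsub le_rfl
  have hac := hle.absolutelyContinuous
  have hO : IsOpen Ω := hΩ.isOpen
  have hq1 : ContDiff ℝ 1 (qh T) := contDiff_of_isPoly (hqh T hT)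
  have hu1 : ContDiff ℝ 1 (uh T) := (huh T hT).contDiff
  obtain ⟨⟨hu2, A, hA, hA2⟩, ⟨hq2, D, hD, hD2⟩, hflux, hbal, -⟩ := hqu
  have eA := (hA.weakGrad_ae_eq hO).filter_mono (ae_mono hle)
  have eD := (hD.weakDiv_ae_eq hO).filter_mono (ae_mono hle)
  have eG := weakGrad_sub_ae_eq (T := T) hsub hA hu1
  have eV := weakDiv_sub_ae_eq (T := T) hsub hD hq1
  have hflux' := hflux.filter_mono (ae_mono hle)
  have hbal' := hbal.filter_mono (ae_mono hle)
  set Wg := weakGrad (interior (hull T)) (fun x => u x - uh T x)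
  set Wd := weakDiv (interior (hull T)) (fun x => q x - qh T x)
  have hcont {E : Type} [NormedAddCommGroup E] {w : Pt d → E} (hw : Continuous w) :
      MemLp w 2 (elemMeasure T) := by
    have : IsFiniteMeasure (volume.restrict (hull T)) :=
      inferInstanceAs (IsFiniteMeasure (elemMeasure T))
    exact memLp_restrict_of_continuousOn (isCompact_hull T) hw.continuousOn
  have mq : MemLp (fun x => q x - qh T x) 2 (elemMeasure T) :=
    (hq2.mono_measure hle).sub (hcont hq1.continuous)
  have mu : MemLp (fun x => u x - uh T x) 2 (elemMeasure T) :=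
    (hu2.mono_measure hle).sub (hcont hu1.continuous)
  have mG : MemLp Wg 2 (elemMeasure T) :=
    ((hA2.mono_measure hle).sub (hcont (continuous_gradient hu1))).ae_eq eG.symm
  have mV : MemLp Wd 2 (elemMeasure T) :=
    ((hD2.mono_measure hle).sub (hcont (continuous_divergence hq1))).ae_eq eV.symm
  have hβT : ContinuousOn β (hull T) := hβ.mono (Mesh.hull_subset hT)
  obtain ⟨B, hB⟩ := (isCompact_hull T).exists_bound_of_continuousOn hβT
  have mB : MemLp (fun x => ⟪β x, Wg x⟫) 2 (elemMeasure T) := by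
    refine mG.of_le_mul (c := B) ?_ ?_
    · exact (hβT.aestronglyMeasurable_of_isCompact (isCompact_hull T)
        (measurableSet_hull T)).inner mG.1
    · filter_upwards [ae_restrict_mem (measurableSet_hull T)] with x hx
      exact (norm_inner_le_norm _ _).trans (mul_le_mul_of_nonneg_right (hB x hx) (norm_nonneg _))
  set C := (eLpNorm c ⊤ (volume.restrict Ω)).toReal with hC
  have hcC : ∀ᵐ x ∂(elemMeasure T), ‖c x‖ ≤ C := by
    refine Filter.Eventually.filter_mono (ae_mono hle) ?_
    filter_upwards [ae_le_eLpNormEssSup (f := c) (μ := volume.restrict Ω)] with x hx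
    have hfin : eLpNorm c ⊤ (volume.restrict Ω) ≠ ⊤ := hc.2.ne
    rw [hC, ← toReal_enorm]
    exact ENNReal.toReal_mono hfin (by rwa [eLpNorm_exponent_top])
  have hR : normSq (elemMeasure T) (residual β c f qh uh T)
      ≤ 2 * 1 ^ 2 * normSq (elemMeasure T) (fun x => Wd x + ⟪β x, Wg x⟫)
        + 2 * C ^ 2 * normSq (elemMeasure T) (fun x => u x - uh T x) := by
    refine normSq_le_of_norm_le (mV.add mB) mu ?_
    filter_upwards [eA, eD, eG, eV, hbal', hcC] with x h1 h2 h3 h4 h5 h6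
    -- Insert the balance equation for `f`: the residual is the differential operator applied to the
    -- error.
    have e : residual β c f qh uh T x = (Wd x + ⟪β x, Wg x⟫) + c x * (u x - uh T x) := by
      rw [residual, ← h5, h4, h3, h2, h1, inner_sub_right]
      ring
    rw [e, one_mul]
    refine (norm_add_le _ _).trans (add_le_add le_rfl ?_)
    rw [norm_mul]
    exact mul_le_mul_of_nonneg_right h6 (norm_nonneg _)
  have hQ : normSq (elemMeasure T) (fun x => qh T x + ε • gradient (uh T) x)
      ≤ 2 * 1 ^ 2 * normSq (elemMeasure T) (fun x => q x - qh T x)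
        + 2 * ε ^ 2 * normSq (elemMeasure T) Wg := by
    refine normSq_le_of_norm_le mq mG ?_
    filter_upwards [eA, eG, hflux'] with x h1 h3 h5
    have h6 : q x + ε • A x = 0 := by
      have := congrArg (ε • ·) h5
      simpa [smul_smul, hε.ne', h1] using this
    -- Subtract the exact relation `q + ε ∇u = 0`.
    have e : qh T x + ε • gradient (uh T) x = -(q x - qh T x) - ε • Wg x := by
      rw [h3, smul_sub, ← sub_eq_zero]
      rw [← h6]
      abel
    rw [e, one_mul]
    refine (norm_sub_le _ _).trans ?_
    rw [norm_neg, norm_smul, Real.norm_of_nonneg hε.le]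
  rw [etaElem, ← Real.sqrt_mul (by positivity)]
  refine Real.sqrt_le_sqrt ?_
  have ho := oscSq_nonneg M p ε (residual β c f qh uh) T
  set nR := normSq (elemMeasure T) (residual β c f qh uh T)
  set nQ := normSq (elemMeasure T) (fun x => qh T x + ε • gradient (uh T) x)
  have n1 := normSq_nonneg (elemMeasure T) (fun x => q x - qh T x)
  have n2 := normSq_nonneg (elemMeasure T) (fun x => u x - uh T x)
  have n3 := normSq_nonneg (elemMeasure T) Wg
  have n4 := normSq_nonneg (elemMeasure T) (fun x => Wd x + ⟪β x, Wg x⟫)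
  set N1 := normSq (elemMeasure T) (fun x => q x - qh T x)
  set N2 := normSq (elemMeasure T) (fun x => u x - uh T x)
  set N3 := normSq (elemMeasure T) Wg
  set N4 := normSq (elemMeasure T) (fun x => Wd x + ⟪β x, Wg x⟫)
  set O := oscSq M p ε (residual β c f qh uh) T
  -- On the right, `‖u - u_h‖²` carries no weight, so `α_T² ≤ 1` is what lets it absorb the
  -- `c`-term.
  have hα0 := alpha_nonneg hε T
  have hα1 : alpha ε T ^ 2 ≤ 1 := pow_le_one₀ hα0 (min_le_right _ _)
  have s1 : alpha ε T ^ 2 * nR ≤ 2 * (alpha ε T ^ 2 * N4) + 2 * C ^ 2 * N2 := by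
    calc alpha ε T ^ 2 * nR ≤ alpha ε T ^ 2 * (2 * 1 ^ 2 * N4 + 2 * C ^ 2 * N2) :=
          mul_le_mul_of_nonneg_left hR (sq_nonneg _)
      _ = 2 * (alpha ε T ^ 2 * N4) + alpha ε T ^ 2 * (2 * C ^ 2 * N2) := by ring
      _ ≤ _ := by
          have := mul_le_of_le_one_left (show 0 ≤ 2 * C ^ 2 * N2 by positivity) hα1
          linarith
  have s2 : ε⁻¹ * nQ ≤ 2 * (ε⁻¹ * N1) + 2 * (ε * N3) := by
    calc ε⁻¹ * nQ ≤ ε⁻¹ * (2 * 1 ^ 2 * N1 + 2 * ε ^ 2 * N3) :=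
          mul_le_mul_of_nonneg_left hQ (inv_nonneg.2 hε.le)
      _ = _ := by field_simp
  have p1 : 0 ≤ ε⁻¹ * N1 := by positivity
  have p3 : 0 ≤ ε * N3 := by positivity
  have p4 : 0 ≤ alpha ε T ^ 2 * N4 := by positivity
  -- The factor `2 + 2 C²` multiplies every term on the right; the products not needed for the bound
  -- are dropped as nonnegative.
  have hC2 : 0 ≤ C ^ 2 := sq_nonneg C
  have q1 := mul_nonneg hC2 p1
  have q3 := mul_nonneg hC2 p3
  have q4 := mul_nonneg hC2 p4
  have q5 := mul_nonneg hC2 ho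
  linarith

end Efficiency

end HDG

end

/-! ### The efficiency theorem -/

theorem theorem2p2 (d : ℕ) (hd : d = 2 ∨ d = 3) (Ω : Set (HDG.Pt d))
    (hΩ : HDG.IsPolyhedralDomain Ω) (p : ℕ) (hp : 1 ≤ p) (κ : ℝ)
    (β : HDG.Pt d → HDG.Pt d) (c : HDG.Pt d → ℝ) (hβc : HDG.AdmissibleCoeff Ω β c) :
    ∃ C₁ : ℝ, 0 < C₁ ∧
      ∀ (ε : ℝ), 0 < ε → ε ≤ 1 →
      ∀ (ρ₀ : ℝ), 0 < ρ₀ → ρ₀ ≤ 1 →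
      ∀ (M : HDG.Mesh Ω), M.ShapeRegular κ →
      ∀ (f g : HDG.Pt d → ℝ), MemLp f 2 (volume.restrict Ω) →
      ∀ (q : HDG.Pt d → HDG.Pt d) (u : HDG.Pt d → ℝ), HDG.IsExactSolution M ε β c f g q u →
      ∀ (qh : Finset (HDG.Pt d) → HDG.Pt d → HDG.Pt d)
        (uh uhat : Finset (HDG.Pt d) → HDG.Pt d → ℝ),
        HDG.IsHDGSolution M p ε ρ₀ β c f g qh uh uhat →
      (∀ F ∈ M.interiorFaces, ∀ T₁ ∈ M.elements, ∀ T₂ ∈ M.elements,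
        T₁ ≠ T₂ → F ⊆ T₁ → F ⊆ T₂ →
        HDG.etaInterior ε β qh uh T₁ T₂ F ≤
          C₁ * √(ε ^ (-(1 / 2) : ℝ) * HDG.alpha ε F
                * HDG.normSq (HDG.faceMeasure F)
                    (HDG.normalJump T₁ T₂ F (fun T x => q x - qh T x))
              + HDG.gamma ε β F
                * HDG.normSq (HDG.faceMeasure F)
                    (HDG.jump T₁ T₂ F (fun T x => u x - uh T x)))) ∧
      (∀ F ∈ M.boundaryFaces, ∀ T ∈ M.elements, F ⊆ T →
        HDG.etaBoundary ε β g uh T F ≤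
          C₁ * √(HDG.gamma ε β F
                * HDG.normSq (HDG.faceMeasure F) (fun x => g x - uh T x))) ∧
      (∀ T ∈ M.elements,
        HDG.etaElem ε β c f qh uh T ≤
          C₁ * √(ε⁻¹ * HDG.normSq (HDG.elemMeasure T) (fun x => q x - qh T x)
              + HDG.normSq (HDG.elemMeasure T) (fun x => u x - uh T x)
              + ε * HDG.normSq (HDG.elemMeasure T)
                  (HDG.weakGrad (interior (HDG.hull T)) (fun x => u x - uh T x))
              + HDG.alpha ε T ^ 2 * HDG.normSq (HDG.elemMeasure T)
                  (fun x => HDG.weakDiv (interior (HDG.hull T)) (fun y => q y - qh T y) x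
                    + ⟪β x, HDG.weakGrad (interior (HDG.hull T)) (fun y => u y - uh T y) x⟫)
              + HDG.oscSq M p ε (HDG.residual β c f qh uh) T)) := by
  obtain ⟨m, rfl⟩ : ∃ m, d = m + 1 := ⟨d - 1, by omega⟩
  set C := (eLpNorm c ⊤ (volume.restrict Ω)).toReal
  -- The face estimates are equalities, so the element constant serves for them too once it is at
  -- least `1`.
  have hC : 1 ≤ √(2 + 2 * C ^ 2) := by
    rw [Real.one_le_sqrt]
    linarith [sq_nonneg C]
  refine ⟨√(2 + 2 * C ^ 2), zero_lt_one.trans_le hC, ?_⟩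
  intro ε hε _ ρ₀ _ _ M _ f g _ q u hqu qh uh uhat hh
  refine ⟨fun F hF T₁ h₁ T₂ h₂ hne hF₁ hF₂ => ?_, fun F _ T _ _ => ?_, fun T hT => ?_⟩
  · rw [HDG.etaInterior_eq hΩ β hqu.u_mem hqu.q_mem hh.q_mem hh.u_mem
      (Finset.mem_filter.1 hF).1 h₁ h₂ hne hF₁ hF₂]
    exact le_mul_of_one_le_left (Real.sqrt_nonneg _) hC
  · rw [HDG.etaBoundary_eq hε]
    exact le_mul_of_one_le_left (Real.sqrt_nonneg _) hC
  · exact HDG.etaElem_le hΩ hβc.beta_cont hβc.c_mem hε hqu hh.q_mem hh.u_mem hT
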